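/- Let $L>0$ and let $g\in L^2((0,L)\times(0,L))$ be a complex-valued kernel that depends only on its first variable, i.e. $g(x,y)=g(x)$ for a.e. $(x,y)$ with $g\in L^2(0,L)$. For $T>0$, $u^0\in L^2(0,L)$ and $U\in L^2(0,T)$ (all complex-valued) consider the system $$u_t(t,x)-u_x(t,x)=\int_0^L g(x,y)u(t,y)\,dy,\qquad u(t,L)=U(t),\qquad u(0,x)=u^0(x),\qquad t\in(0,T),\ x\in(0,L),$$ where a solution is a function $u\in C^0([0,T];L^2(0,L))$ such that, for every $\tau\in[0,T]$ and every $\phi\in C^1([0,\tau]\times[0,L])$ with $\phi(\cdot,0)=0$, $$\int_0^\tau\!\!\int_0^L u\,\overline{\Big(-\phi_t+\phi_x-\int_0^L\overline{g(y,x)}\phi(t,y)\,dy\Big)}dx\,dt+\int_0^L u(\tau,x)\overline{\phi(\tau,x)}\,dx-\int_0^L u^0(x)\overline{\phi(0,x)}\,dx-\int_0^\tau U(t)\overline{\phi(t,L)}\,dt=0 .$$ The system is exactly controllable at time $T$ if for all $u^0,u^1\in L^2(0,L)$ there is $U\in L^2(0,T)$ such that the corresponding solution satisfies $u(T)=u^1$.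 Let $A$ be the unbounded operator on $L^2(0,L)$ with $D(A)=\{u\in H^1(0,L): u(L)=0\}$ and $Au=u_x+\int_0^L g(\cdot,y)u(y)\,dy$, let $A^*$ be its adjoint (whose domain is $D(A^*)=\{z\in H^1(0,L): z(0)=0\}$), and let $B^*:D(A^*)\to\mathbb C$ be given by $B^*z=z(L)$. Then the system is exactly controllable at time $T=L$ if and only if $$\ker(\lambda-A^*)\cap\ker B^*=\{0\}\qquad\text{for every }\lambda\in\mathbb C .$$ -/

import Mathlib

noncomputable section

namespace TransportControl

open MeasureTheory Set
open scoped ComplexConjugate ContDiff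

/-- Lebesgue measure on the interval `(0, L)`. -/
abbrev intervalMeasure (L : ℝ) : Measure ℝ := volume.restrict (Ioo 0 L)

/-- The complex Hilbert space `L²(0, L)`. -/
abbrev L2 (L : ℝ) : Type := Lp ℂ 2 (intervalMeasure L)

/-- Lebesgue measure on the square `(0, L) × (0, L)`. -/
abbrev squareMeasure (L : ℝ) : Measure (ℝ × ℝ) :=
  (intervalMeasure L).prod (intervalMeasure L)

/-- The space `L²((0, L) × (0, L))` of kernels. -/
abbrev Kernel2 (L : ℝ) : Type := Lp ℂ 2 (squareMeasure L)

/-! ### Weak solutions and exact controllability -/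

/-- `u` is a (weak) solution on `[0, T]` of
`u_t - u_x = ∫₀ᴸ G(x, y) u(t, y) dy`, `u(t, L) = U(t)`, `u(0, x) = u₀(x)`:
`u ∈ C⁰([0, T]; L²(0, L))` (values of `u` outside `[0, T]` play no role), and the equation holds
against all test functions `φ ∈ C¹([0, τ] × [0, L])` with `φ(·, 0) = 0`, for all `τ ∈ [0, T]`.
The `C¹` functions on the closed rectangle are given as restrictions of `C¹` functions on the
plane. -/
structure IsWeakSolution (L : ℝ) (G : Kernel2 L) (T : ℝ) (u₀ : L2 L) (U : L2 T)
    (u : ℝ → L2 L) : Prop where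
  continuousOn : ContinuousOn u (Icc 0 T)
  weak_eq : ∀ τ ∈ Icc 0 T, ∀ φ : ℝ × ℝ → ℂ, ContDiff ℝ 1 φ →
    (∀ t ∈ Icc 0 τ, φ (t, 0) = 0) →
    (∫ t in Ioo 0 τ, ∫ x in Ioo 0 L, u t x *
        conj (-deriv (fun s => φ (s, x)) t + deriv (fun y => φ (t, y)) x
          - ∫ y in Ioo 0 L, conj (G (y, x)) * φ (t, y)))
      + (∫ x in Ioo 0 L, u τ x * conj (φ (τ, x)))
      - (∫ x in Ioo 0 L, u₀ x * conj (φ (0, x)))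
      - (∫ t in Ioo 0 τ, U t * conj (φ (t, L))) = 0

/-- Exact controllability at time `T`: every initial state `u₀` can be steered to every
target `u₁` at time `T` by some control `U ∈ L²(0, T)`. -/
def ExactlyControllable (L : ℝ) (G : Kernel2 L) (T : ℝ) : Prop :=
  ∀ u₀ u₁ : L2 L, ∃ U : L2 T, ∃ u : ℝ → L2 L, IsWeakSolution L G T u₀ U u ∧ u T = u₁

/-! ### Weak derivatives and boundary values -/

/-- `v ∈ L²(0, L)` is the weak derivative of `u ∈ L²(0, L)` on `(0, L)`. -/
def IsWeakDeriv (L : ℝ) (u v : L2 L) : Prop :=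
  ∀ φ : ℝ → ℝ, ContDiff ℝ ∞ φ → HasCompactSupport φ → tsupport φ ⊆ Ioo 0 L →
    ∫ x in Ioo 0 L, deriv φ x • u x = -∫ x in Ioo 0 L, φ x • v x

/-- The continuous representative of `u` on `[0, L]` exists and has value `c` at `x`. -/
def HasTrace (L : ℝ) (u : L2 L) (x : ℝ) (c : ℂ) : Prop :=
  ∃ w : ℝ → ℂ, ContinuousOn w (Icc 0 L) ∧ u =ᵐ[intervalMeasure L] w ∧ w x = c

theorem integrable_smul_test {L : ℝ} (u : L2 L) {φ : ℝ → ℝ} (hφ : Continuous φ)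
    (hc : HasCompactSupport φ) :
    Integrable (fun x => φ x • u x) (intervalMeasure L) := by
  have hu : Integrable (u : ℝ → ℂ) (intervalMeasure L) :=
    (Lp.memLp u).integrable (by norm_num)
  obtain ⟨C, hC⟩ := hc.exists_bound_of_continuous hφ
  exact hu.bdd_smul C hφ.aestronglyMeasurable (Filter.Eventually.of_forall hC)

theorem IsWeakDeriv.unique {L : ℝ} {u v w : L2 L}
    (hv : IsWeakDeriv L u v) (hw : IsWeakDeriv L u w) : v = w := by
  have key : ∀ᵐ x, x ∈ Ioo 0 L → (v x - w x : ℂ) = 0 := by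
    refine isOpen_Ioo.ae_eq_zero_of_integral_contDiff_smul_eq_zero ?_ ?_
    · have h1 : Integrable (v : ℝ → ℂ) (intervalMeasure L) :=
        (Lp.memLp v).integrable (by norm_num)
      have h2 : Integrable (w : ℝ → ℂ) (intervalMeasure L) :=
        (Lp.memLp w).integrable (by norm_num)
      have h3 : IntegrableOn (fun x => (v x - w x : ℂ)) (Ioo 0 L) volume := h1.sub h2
      exact h3.locallyIntegrableOn
    · intro φ h1 h2 h3
      have hsub : ∫ x in Ioo 0 L, φ x • (v x - w x : ℂ) = 0 := by
        simp only [smul_sub]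
        rw [integral_sub (integrable_smul_test v h1.continuous h2)
          (integrable_smul_test w h1.continuous h2)]
        have e1 := hv φ h1 h2 h3
        have e2 := hw φ h1 h2 h3
        rw [e1] at e2
        rw [neg_injective e2, sub_self]
      rw [← hsub]
      symm
      apply setIntegral_eq_integral_of_forall_compl_eq_zero
      intro x hx
      have : φ x = 0 := by
        by_contra hne
        exact hx (h3 (subset_tsupport _ hne))
      simp [this]
  apply Lp.ext
  have := (ae_restrict_iff' (μ := volume) (measurableSet_Ioo (a := (0 : ℝ)) (b := L))).2 key
  filter_upwards [this] with x hx
  exact sub_eq_zero.1 hx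

theorem IsWeakDeriv.zero (L : ℝ) : IsWeakDeriv L 0 0 := by
  intro φ _ _ _
  have h : ((0 : L2 L) : ℝ → ℂ) =ᵐ[intervalMeasure L] 0 := Lp.coeFn_zero ..
  rw [integral_eq_zero_of_ae (by filter_upwards [h] with x hx; rw [hx]; simp),
    integral_eq_zero_of_ae (by filter_upwards [h] with x hx; rw [hx]; simp), neg_zero]

theorem IsWeakDeriv.add {L : ℝ} {u v u' v' : L2 L} (h : IsWeakDeriv L u v)
    (h' : IsWeakDeriv L u' v') : IsWeakDeriv L (u + u') (v + v') := by
  intro φ h1 h2 h3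
  have hd : Continuous (deriv φ) := h1.continuous_deriv (by simp)
  have e1 : ∫ x in Ioo 0 L, deriv φ x • (u + u') x
      = ∫ x in Ioo 0 L, (deriv φ x • u x + deriv φ x • u' x) := by
    apply integral_congr_ae
    filter_upwards [Lp.coeFn_add u u'] with x hx
    rw [hx, Pi.add_apply, smul_add]
  have e2 : ∫ x in Ioo 0 L, φ x • (v + v') x
      = ∫ x in Ioo 0 L, (φ x • v x + φ x • v' x) := by
    apply integral_congr_ae
    filter_upwards [Lp.coeFn_add v v'] with x hx
    rw [hx, Pi.add_apply, smul_add]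
  rw [e1, e2, integral_add (integrable_smul_test u hd h2.deriv)
    (integrable_smul_test u' hd h2.deriv),
    integral_add (integrable_smul_test v h1.continuous h2)
    (integrable_smul_test v' h1.continuous h2), h φ h1 h2 h3, h' φ h1 h2 h3]
  ring

theorem IsWeakDeriv.smul {L : ℝ} {u v : L2 L} (c : ℂ) (h : IsWeakDeriv L u v) :
    IsWeakDeriv L (c • u) (c • v) := by
  intro φ h1 h2 h3
  have e1 : ∫ x in Ioo 0 L, deriv φ x • (c • u) x
      = ∫ x in Ioo 0 L, c • (deriv φ x • u x) := by
    apply integral_congr_ae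
    filter_upwards [Lp.coeFn_smul c u] with x hx
    rw [hx, Pi.smul_apply, smul_comm]
  have e2 : ∫ x in Ioo 0 L, φ x • (c • v) x
      = ∫ x in Ioo 0 L, c • (φ x • v x) := by
    apply integral_congr_ae
    filter_upwards [Lp.coeFn_smul c v] with x hx
    rw [hx, Pi.smul_apply, smul_comm]
  rw [e1, e2, integral_smul, integral_smul, h φ h1 h2 h3, smul_neg]

theorem HasTrace.zero (L x : ℝ) : HasTrace L 0 x 0 :=
  ⟨0, continuousOn_const, Lp.coeFn_zero .., rfl⟩

theorem HasTrace.add {L x : ℝ} {u u' : L2 L} {c c' : ℂ} (h : HasTrace L u x c)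
    (h' : HasTrace L u' x c') : HasTrace L (u + u') x (c + c') := by
  obtain ⟨w, h1, h2, h3⟩ := h
  obtain ⟨w', h1', h2', h3'⟩ := h'
  exact ⟨w + w', h1.add h1', (Lp.coeFn_add u u').trans (h2.add h2'), by simp [h3, h3']⟩

theorem HasTrace.smul {L x : ℝ} {u : L2 L} {c : ℂ} (a : ℂ) (h : HasTrace L u x c) :
    HasTrace L (a • u) x (a * c) := by
  obtain ⟨w, h1, h2, h3⟩ := h
  exact ⟨a • w, h1.const_smul a, (Lp.coeFn_smul a u).trans (h2.const_smul a), by simp [h3]⟩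

/-! ### The integral operator with kernel `G` -/

theorem kernel_slice_memLp {L : ℝ} (G : Kernel2 L) :
    ∀ᵐ x ∂(intervalMeasure L), MemLp (fun y => G (x, y)) 2 (intervalMeasure L) := by
  have h := Lp.memLp G
  have hsq := (memLp_two_iff_integrable_sq_norm h.1).1 h
  filter_upwards [hsq.prod_right_ae, h.1.prodMk_left] with x h1 h2
  exact (memLp_two_iff_integrable_sq_norm h2).2 h1

theorem kernel_slice_integrable {L : ℝ} (G : Kernel2 L) (u : L2 L) :
    ∀ᵐ x ∂(intervalMeasure L),
      Integrable (fun y => G (x, y) * u y) (intervalMeasure L) := by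
  filter_upwards [kernel_slice_memLp G] with x hx
  exact hx.integrable_mul (Lp.memLp u)

theorem memLp_intOp {L : ℝ} (G : Kernel2 L) (u : L2 L) :
    MemLp (fun x => ∫ y in Ioo 0 L, G (x, y) * u y) 2 (intervalMeasure L) := by
  have h := Lp.memLp G
  have hm : AEStronglyMeasurable (fun p : ℝ × ℝ => G p * u p.2) (squareMeasure L) :=
    h.1.mul (Lp.memLp u).1.comp_snd
  have hsq := (memLp_two_iff_integrable_sq_norm h.1).1 h
  have hm' : AEStronglyMeasurable (fun x => ∫ y in Ioo 0 L, G (x, y) * u y)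
      (intervalMeasure L) := hm.integral_prod_right'
  rw [memLp_two_iff_integrable_sq_norm hm']
  refine Integrable.mono' (hsq.integral_prod_left.mul_const
    (∫ y in Ioo 0 L, ‖u y‖ ^ 2)) (hm'.norm.pow 2) ?_
  filter_upwards [kernel_slice_memLp G] with x hx
  rw [Real.norm_of_nonneg (by positivity)]
  have hu := Lp.memLp u
  have cs := integral_mul_norm_le_Lp_mul_Lq (μ := intervalMeasure L) (p := 2) (q := 2)
    (f := fun y => G (x, y)) (g := u) Real.HolderConjugate.two_two
    (by simpa using hx) (by simpa using hu)
  have h0 : ‖∫ y in Ioo 0 L, G (x, y) * u y‖ ≤ ∫ y in Ioo 0 L, ‖G (x, y)‖ * ‖u y‖ := by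
    refine (norm_integral_le_integral_norm _).trans_eq ?_
    simp only [norm_mul]
  have h1 := h0.trans cs
  have p1 : 0 ≤ ∫ y in Ioo 0 L, ‖G (x, y)‖ ^ 2 := by positivity
  have p2 : 0 ≤ ∫ y in Ioo 0 L, ‖u y‖ ^ 2 := by positivity
  simp only [Real.rpow_two, ← Real.sqrt_eq_rpow] at h1
  calc ‖∫ y in Ioo 0 L, G (x, y) * u y‖ ^ 2 ≤ _ := pow_le_pow_left₀ (norm_nonneg _) h1 2
    _ = _ := by rw [mul_pow, Real.sq_sqrt p1, Real.sq_sqrt p2]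

/-- The integral operator `u ↦ ∫₀ᴸ G(·, y) u(y) dy` on `L²(0, L)`. -/
def intOp {L : ℝ} (G : Kernel2 L) : L2 L →ₗ[ℂ] L2 L where
  toFun u := (memLp_intOp G u).toLp
  map_add' u v := by
    apply Lp.ext
    refine (MemLp.coeFn_toLp _).trans (.trans ?_ (Lp.coeFn_add _ _).symm)
    filter_upwards [kernel_slice_integrable G u, kernel_slice_integrable G v,
      (memLp_intOp G u).coeFn_toLp, (memLp_intOp G v).coeFn_toLp] with x h1 h2 h3 h4
    rw [Pi.add_apply, h3, h4, ← integral_add h1 h2]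
    apply integral_congr_ae
    filter_upwards [Lp.coeFn_add u v] with y hy
    rw [hy, Pi.add_apply, mul_add]
  map_smul' c u := by
    apply Lp.ext
    refine (MemLp.coeFn_toLp _).trans (.trans ?_ (Lp.coeFn_smul _ _).symm)
    filter_upwards [(memLp_intOp G u).coeFn_toLp] with x h3
    rw [Pi.smul_apply, RingHom.id_apply, h3, ← integral_smul]
    apply integral_congr_ae
    filter_upwards [Lp.coeFn_smul c u] with y hy
    rw [hy, Pi.smul_apply, smul_eq_mul, smul_eq_mul]
    ring

/-! ### The operators `A`, `A*` and the kernels `ker (μ - A*)`, `ker B*` -/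

/-- `D(A) = {u ∈ H¹(0, L) : u(L) = 0}`. -/
def domA (L : ℝ) : Submodule ℂ (L2 L) where
  carrier := {u | (∃ v, IsWeakDeriv L u v) ∧ HasTrace L u L 0}
  zero_mem' := ⟨⟨0, IsWeakDeriv.zero L⟩, HasTrace.zero L L⟩
  add_mem' := by
    rintro u u' ⟨⟨v, hv⟩, h⟩ ⟨⟨v', hv'⟩, h'⟩
    exact ⟨⟨v + v', hv.add hv'⟩, by simpa using h.add h'⟩
  smul_mem' := by
    rintro c u ⟨⟨v, hv⟩, h⟩
    exact ⟨⟨c • v, hv.smul c⟩, by simpa using h.smul c⟩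

/-- The weak derivative `u ↦ u_x` on `D(A)`. -/
def weakDeriv (L : ℝ) : domA L →ₗ[ℂ] L2 L where
  toFun u := u.2.1.choose
  map_add' u v := (u + v).2.1.choose_spec.unique (u.2.1.choose_spec.add v.2.1.choose_spec)
  map_smul' c u := (c • u).2.1.choose_spec.unique (u.2.1.choose_spec.smul c)

theorem weakDeriv_spec {L : ℝ} (u : domA L) : IsWeakDeriv L u (weakDeriv L u) :=
  u.2.1.choose_spec

/-- The unbounded operator `A u = u_x + ∫₀ᴸ G(·, y) u(y) dy` with domain `D(A)`. -/
def opA {L : ℝ} (G : Kernel2 L) : L2 L →ₗ.[ℂ] L2 L where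
  domain := domA L
  toFun := weakDeriv L + (intOp G).comp (domA L).subtype

/-- The adjoint `A*` of the densely defined operator `A`. -/
def adjA {L : ℝ} (G : Kernel2 L) : L2 L →ₗ.[ℂ] L2 L := (opA G).adjoint

/-- `ker (μ - A*)`. -/
def kerAdjA {L : ℝ} (G : Kernel2 L) (μ : ℂ) : Set (L2 L) :=
  {z | ∃ h : z ∈ (adjA G).domain, μ • z - adjA G ⟨z, h⟩ = 0}

/-- `ker B*`, where `B* : D(A*) → ℂ` is the boundary value `B* z = z(L)`. -/
def kerAdjB {L : ℝ} (G : Kernel2 L) : Set (L2 L) :=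
  {z | z ∈ (adjA G).domain ∧ HasTrace L z L 0}

/-- The Fattorini criterion: `ker (μ - A*) ∩ ker B* = {0}` for every complex `μ`. -/
def FattoriniCriterion {L : ℝ} (G : Kernel2 L) : Prop :=
  ∀ μ : ℂ, kerAdjA G μ ∩ kerAdjB G = {0}

end TransportControl

end

noncomputable section

namespace TransportControl

open MeasureTheory Set
open scoped ComplexConjugate ContDiff

/-! ### Elementary facts on `L²(0, L)` -/

/-! Since the kernel depends on `x` only, the nonlocal term is `g(x) ∫ u(t, ·)`: a rank-one
perturbation of transport. Both sides of the equivalence reduce to a scalar condition,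
`Nonresonant`.

Write `E_l(x) = ∫₀ˣ exp (-l s) ds`. An eigenfunction of `A*` solves `z' + l z = const`, `z(0) = 0`,
so it is a multiple of `E_l`; inserting this into the constant forces `∫ g conj E_l = 1`, and `B* z
= 0` forces `E_l(L) = 0`. So the Fattorini criterion says that these two equations never hold
together (`fattorini_of_nonresonant`, `nonresonant_of_fattorini`).

Necessity of nonresonance for control: if both equations hold, `exp (-l t) E_l(x)` solves the
adjoint equation and vanishes at `x = 0` and `x = L`. The control does not act on it, so the zero
state cannot be steered to `E_l` (`nonresonant_of_exactlyControllable`).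

Sufficiency: let `I(t) = ∫ u(t, ·)` and `Γ(r) = ∫ᵣᴸ g`. Along characteristics `u(t, x) = w(x + t) +
∫₀ᵗ I(s) g(x + t - s) ds`, where `g` is extended by zero and `w` is `u₀` on `(0, L)` followed by `U`
on `(L, 2L)`. At time `L` this is `U + D`, where `D` depends on `I` alone, so `U = u₁ - D` hits the
target whatever `I` is. What remains is consistency: `I` must be the mean of the resulting `u`. This
is an integral equation whose kernel, on `(0, L)`, is the `L`-periodization of `Γ`, up to a term
constant in `t`. In Fourier coefficients the `n`-th mode is multiplied by `1 - ∫ g E_l`, `l =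
2πin/L`, which nonresonance makes nonzero for `n ≠ 0`; these factors tend to `1`, so division
preserves `ℓ²`. The mode `n = 0` is absorbed by the constant term (`exists_convolution_solution`,
`exists_integral_equation_solution`). Finally, `isWeakSolution_mildSolution` verifies the weak
formulation. -/

theorem L2.integrable {L : ℝ} (u : L2 L) : Integrable (u : ℝ → ℂ) (intervalMeasure L) :=
  (Lp.memLp u).integrable (by norm_num)

theorem memLp_of_continuous (L : ℝ) {f : ℝ → ℂ} (hf : Continuous f) :
    MemLp f 2 (intervalMeasure L) := by
  obtain ⟨C, hC⟩ := (isCompact_Icc (a := (0 : ℝ)) (b := L)).exists_bound_of_continuousOn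
    hf.continuousOn
  refine MemLp.of_bound hf.aestronglyMeasurable C ?_
  filter_upwards [ae_restrict_mem measurableSet_Ioo] with x hx
  exact hC x (Ioo_subset_Icc_self hx)

theorem integrable_of_continuous (L : ℝ) {f : ℝ → ℂ} (hf : Continuous f) :
    Integrable f (intervalMeasure L) :=
  (memLp_of_continuous L hf).integrable (by norm_num)

/-- A continuous function, as an element of `L²(0, L)`. -/
def ofContinuous (L : ℝ) (f : ℝ → ℂ) (hf : Continuous f) : L2 L :=
  (memLp_of_continuous L hf).toLp

theorem coeFn_ofContinuous (L : ℝ) {f : ℝ → ℂ} (hf : Continuous f) :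
    ofContinuous L f hf =ᵐ[intervalMeasure L] f :=
  MemLp.coeFn_toLp _

theorem integrable_mul_continuous {L : ℝ} {v f : ℝ → ℂ} (hv : Integrable v (intervalMeasure L))
    (hf : Continuous f) : Integrable (fun x => v x * f x) (intervalMeasure L) := by
  obtain ⟨C, hC⟩ := (isCompact_Icc (a := (0 : ℝ)) (b := L)).exists_bound_of_continuousOn
    hf.continuousOn
  refine hv.mul_bdd (c := C) hf.aestronglyMeasurable ?_
  filter_upwards [ae_restrict_mem measurableSet_Ioo] with x hx
  exact hC x (Ioo_subset_Icc_self hx)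

theorem inner_eq_integral {L : ℝ} (z u : L2 L) :
    inner ℂ z u = ∫ x in Ioo 0 L, u x * conj (z x) := by
  rw [MeasureTheory.L2.inner_def]
  rfl

theorem setIntegral_Ioo_eq {L : ℝ} (hL : 0 ≤ L) (f : ℝ → ℂ) :
    ∫ x in Ioo 0 L, f x = ∫ x in (0 : ℝ)..L, f x := by
  rw [intervalIntegral.integral_of_le hL, integral_Ioc_eq_integral_Ioo]

/-! ### The weak derivative -/

/-- Fubini on the triangle `y < x`: for fixed `y` the integral of `z'` over `(y, L)` is `-z(y)`.
This is integration by parts when `v` is only integrable. -/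
theorem integral_deriv_mul_primitive {L : ℝ} {z z' v : ℝ → ℂ}
    (hz : ∀ x, HasDerivAt z (z' x) x) (hz' : Continuous z') (hzL : z L = 0)
    (hv : Integrable v (intervalMeasure L)) :
    ∫ x in Ioo 0 L, z' x * (∫ y in Ioo 0 x, v y) = -∫ x in Ioo 0 L, z x * v x := by
  have hint : Integrable (fun p : ℝ × ℝ => {q : ℝ × ℝ | q.2 < q.1}.indicator
      (fun q => z' q.1 * v q.2) p) ((intervalMeasure L).prod (intervalMeasure L)) :=
    ((integrable_of_continuous L hz').mul_prod hv).indicator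
      (measurableSet_lt measurable_snd measurable_fst)
  have hswap := integral_integral_swap (μ := intervalMeasure L) (ν := intervalMeasure L)
    (f := fun x y => {q : ℝ × ℝ | q.2 < q.1}.indicator (fun q => z' q.1 * v q.2) (x, y)) hint
  have e1 : ∀ x ∈ Ioo 0 L, z' x * (∫ y in Ioo 0 x, v y) = ∫ y in Ioo 0 L,
      {q : ℝ × ℝ | q.2 < q.1}.indicator (fun q => z' q.1 * v q.2) (x, y) := by
    intro x hx
    rw [← integral_const_mul]
    have : ∀ y, {q : ℝ × ℝ | q.2 < q.1}.indicator (fun q => z' q.1 * v q.2) (x, y)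
        = (Iio x).indicator (fun y => z' x * v y) y := by
      intro y; simp [indicator]
    simp only [this]
    rw [setIntegral_indicator measurableSet_Iio]
    congr 2
    ext y; simp only [mem_Ioo, mem_inter_iff, mem_Iio] at *
    constructor
    · rintro ⟨a, b⟩; exact ⟨⟨a, b.trans hx.2⟩, b⟩
    · rintro ⟨a, b⟩; exact ⟨a.1, b⟩
  have e2 : ∀ y ∈ Ioo 0 L, (∫ x in Ioo 0 L,
      {q : ℝ × ℝ | q.2 < q.1}.indicator (fun q => z' q.1 * v q.2) (x, y)) = -(z y * v y) := by
    intro y hy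
    have : ∀ x, {q : ℝ × ℝ | q.2 < q.1}.indicator (fun q => z' q.1 * v q.2) (x, y)
        = (Ioi y).indicator (fun x => z' x * v y) x := by
      intro x; simp [indicator]
    simp only [this]
    rw [setIntegral_indicator measurableSet_Ioi]
    have hs : Ioo 0 L ∩ Ioi y = Ioo y L := by
      ext x; simp only [mem_Ioo, mem_inter_iff, mem_Ioi] at *
      constructor
      · rintro ⟨a, b⟩; exact ⟨b, a.2⟩
      · rintro ⟨a, b⟩; exact ⟨⟨hy.1.trans a, b⟩, a⟩
    rw [hs, integral_mul_const, ← integral_Ioc_eq_integral_Ioo,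
      ← intervalIntegral.integral_of_le hy.2.le,
      intervalIntegral.integral_eq_sub_of_hasDerivAt (fun x _ => hz x)
        (hz'.intervalIntegrable _ _), hzL]
    ring
  rw [setIntegral_congr_fun measurableSet_Ioo e1, hswap,
    setIntegral_congr_fun measurableSet_Ioo e2, integral_neg]

/-- **Du Bois-Reymond lemma**. -/
theorem ae_eq_const_of_integral_deriv_smul_eq_zero {L : ℝ} (hL : 0 < L) {w : ℝ → ℂ}
    (hw : Integrable w (intervalMeasure L))
    (h : ∀ φ : ℝ → ℝ, ContDiff ℝ ∞ φ → HasCompactSupport φ → tsupport φ ⊆ Ioo 0 L →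
      ∫ x in Ioo 0 L, deriv φ x • w x = 0) :
    ∃ c : ℂ, w =ᵐ[intervalMeasure L] fun _ => c := by
  let b : ContDiffBump (L / 2) := ⟨L / 8, L / 4, by positivity, by linarith⟩
  set ρ : ℝ → ℝ := b.normed volume with hρ
  have hρc : ContDiff ℝ ∞ ρ := b.contDiff_normed
  have hρs : tsupport ρ ⊆ Icc (L / 4) (3 * L / 4) := by
    rw [hρ, b.tsupport_normed_eq, Real.closedBall_eq_Icc]
    apply Icc_subset_Icc <;> simp only [b] <;> linarith
  have hρi : ∫ x, ρ x = 1 := b.integral_normed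
  refine ⟨∫ x in Ioo 0 L, ρ x • w x, ?_⟩
  set c := ∫ x in Ioo 0 L, ρ x • w x
  have bdd : ∀ {ψ : ℝ → ℝ}, Continuous ψ → HasCompactSupport ψ →
      Integrable (fun x => ψ x • w x) (intervalMeasure L) := by
    intro ψ h1 h2
    obtain ⟨C, hC⟩ := h2.exists_bound_of_continuous h1
    exact hw.bdd_smul C h1.aestronglyMeasurable (Filter.Eventually.of_forall hC)
  have key : ∀ᵐ x, x ∈ Ioo 0 L → w x - c = 0 := by
    refine isOpen_Ioo.ae_eq_zero_of_integral_contDiff_smul_eq_zero ?_ ?_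
    · have h3 : IntegrableOn (fun x => (w x - c : ℂ)) (Ioo 0 L) volume :=
        hw.sub (integrable_const c)
      exact h3.locallyIntegrableOn
    · intro ψ h1 h2 h3
      have hψi : Integrable ψ := h1.continuous.integrable_of_hasCompactSupport h2
      have hρint : Integrable ρ := b.continuous.div_const _ |>.integrable_of_hasCompactSupport
        b.hasCompactSupport_normed
      set m := ∫ x, ψ x with hm
      -- Removing `m` times the unit bump gives mean zero, so that the primitive of `η` is again an
      -- admissible test function.
      set η : ℝ → ℝ := fun x => ψ x - m * ρ x with hη
      have hηc : ContDiff ℝ ∞ η := h1.sub (contDiff_const.mul hρc)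
      have hηi : ∫ x, η x = 0 := by
        rw [hη, integral_sub hψi (hρint.const_mul m), integral_const_mul, hρi, ← hm]; ring
      obtain ⟨a, e, ha, he, hsub⟩ : ∃ a e : ℝ, 0 < a ∧ e < L ∧ ∀ x, x ∉ Icc a e → η x = 0 := by
        obtain ⟨a, e, ha, he, hsub⟩ : ∃ a e : ℝ, 0 < a ∧ e < L ∧ tsupport ψ ⊆ Icc a e := by
          rcases (tsupport ψ).eq_empty_or_nonempty with h0 | h0
          · exact ⟨L, 0, hL, hL, by simp [h0]⟩
          · have i1 := h2.isCompact.sInf_mem h0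
            have i2 := h2.isCompact.sSup_mem h0
            exact ⟨sInf (tsupport ψ), sSup (tsupport ψ), (h3 i1).1, (h3 i2).2, fun x hx =>
              ⟨csInf_le h2.isCompact.bddBelow hx, le_csSup h2.isCompact.bddAbove hx⟩⟩
        refine ⟨min a (L / 4), max e (3 * L / 4), lt_min ha (by linarith),
          max_lt he (by linarith), fun x hx => ?_⟩
        have n1 : x ∉ tsupport ψ := fun hx' => hx
          ⟨(min_le_left _ _).trans (hsub hx').1, (hsub hx').2.trans (le_max_left _ _)⟩
        have n2 : x ∉ tsupport ρ := fun hx' => hx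
          ⟨(min_le_right _ _).trans (hρs hx').1, (hρs hx').2.trans (le_max_right _ _)⟩
        simp [hη, image_eq_zero_of_notMem_tsupport n1, image_eq_zero_of_notMem_tsupport n2]
      set φ : ℝ → ℝ := fun x => ∫ y in (0 : ℝ)..x, η y with hφ
      have hd : ∀ x, HasDerivAt φ (η x) x := fun x =>
        intervalIntegral.integral_hasDerivAt_right (hηc.continuous.intervalIntegrable _ _)
          (hηc.continuous.stronglyMeasurableAtFilter _ _) hηc.continuous.continuousAt
      have hderiv : deriv φ = η := funext fun x => (hd x).deriv
      have hφc : ContDiff ℝ ∞ φ := by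
        rw [contDiff_infty_iff_deriv]
        exact ⟨fun x => (hd x).differentiableAt, hderiv ▸ hηc⟩
      -- To the left of `a` the integrand vanishes; to the right of `e` the integral is already the
      -- full mean of `η`, which is zero.
      have hφ0 : ∀ x, x ∉ Icc a e → φ x = 0 := by
        intro x hx
        rcases lt_or_ge x a with hxa | hxa
        · simp only [hφ]
          rw [intervalIntegral.integral_congr (g := fun _ => 0), intervalIntegral.integral_zero]
          intro y hy
          apply hsub
          rintro ⟨hy1, -⟩
          rcases le_total 0 x with h0 | h0
          · rw [uIcc_of_le h0] at hy; linarith [hy.2]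
          · rw [uIcc_of_ge h0] at hy; linarith [hy.2]
        · have hxe : e < x := by
            by_contra hcon; exact hx ⟨hxa, not_lt.1 hcon⟩
          have h0x : 0 ≤ x := ha.le.trans hxa
          rw [← hηi, hφ]
          simp only
          rw [intervalIntegral.integral_of_le h0x]
          apply setIntegral_eq_integral_of_forall_compl_eq_zero
          intro y hy
          apply hsub
          rintro ⟨hy1, hy2⟩
          exact hy ⟨ha.trans_le hy1, hy2.trans hxe.le⟩
      have hts : tsupport φ ⊆ Icc a e :=
        closure_minimal (fun x hx => by by_contra hcon; exact hx (hφ0 x hcon)) isClosed_Icc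
      have hφs : HasCompactSupport φ := isCompact_Icc.of_isClosed_subset (isClosed_tsupport φ) hts
      have main := h φ hφc hφs
        (hts.trans fun x hx => ⟨ha.trans_le hx.1, hx.2.trans_lt he⟩)
      rw [hderiv] at main
      have e1 : ∫ x in Ioo 0 L, η x • w x = (∫ x in Ioo 0 L, ψ x • w x) - m • c := by
        rw [← integral_smul, ← integral_sub (bdd h1.continuous h2)
          ((bdd hρc.continuous b.hasCompactSupport_normed).fun_smul m)]
        congr 1; ext x; simp only [hη, sub_smul, mul_smul]
      have e2 : ∫ x in Ioo 0 L, ψ x • c = m • c := by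
        rw [integral_smul_const]
        congr 1
        apply setIntegral_eq_integral_of_forall_compl_eq_zero
        intro x hx
        by_contra hne
        exact hx (h3 (subset_tsupport _ hne))
      have e3 : ∫ x in Ioo 0 L, ψ x • (w x - c) = 0 := by
        simp only [smul_sub]
        rw [integral_sub (bdd h1.continuous h2) (hψi.restrict.smul_const c), e2, ← e1, main]
      rw [← e3]
      symm
      apply setIntegral_eq_integral_of_forall_compl_eq_zero
      intro x hx
      have : ψ x = 0 := by
        by_contra hne
        exact hx (h3 (subset_tsupport _ hne))
      simp [this]
  have := (ae_restrict_iff' (μ := volume) (measurableSet_Ioo (a := (0 : ℝ)) (b := L))).2 key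
  filter_upwards [this] with x hx
  exact sub_eq_zero.1 hx

theorem memLp_primitive {L : ℝ} {v : ℝ → ℂ} (hv : Integrable v (intervalMeasure L)) :
    MemLp (fun x => ∫ y in Ioo 0 x, v y) 2 (intervalMeasure L) := by
  have hm : AEStronglyMeasurable (fun x => ∫ y in Ioo 0 x, v y) (intervalMeasure L) := by
    have h1 : AEStronglyMeasurable (fun p : ℝ × ℝ => {q : ℝ × ℝ | q.2 < q.1}.indicator
        (fun q => v q.2) p) ((intervalMeasure L).prod (intervalMeasure L)) :=
      hv.1.comp_snd.indicator (measurableSet_lt measurable_snd measurable_fst)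
    refine h1.integral_prod_right'.congr ?_
    filter_upwards [ae_restrict_mem measurableSet_Ioo] with x hx
    have : ∀ y, {q : ℝ × ℝ | q.2 < q.1}.indicator (fun q => v q.2) (x, y)
        = (Iio x).indicator v y := by
      intro y; simp [indicator]
    simp only [this]
    rw [setIntegral_indicator measurableSet_Iio]
    congr 2
    ext y; simp only [mem_Ioo, mem_inter_iff, mem_Iio] at *
    constructor
    · rintro ⟨a, b⟩; exact ⟨a.1, b⟩
    · rintro ⟨a, b⟩; exact ⟨⟨a, b.trans hx.2⟩, b⟩
  refine MemLp.of_bound hm (∫ y in Ioo 0 L, ‖v y‖) ?_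
  filter_upwards [ae_restrict_mem measurableSet_Ioo] with x hx
  refine (norm_integral_le_integral_norm _).trans ?_
  exact setIntegral_mono_set hv.norm (Filter.Eventually.of_forall fun _ => norm_nonneg _)
    (Ioo_subset_Ioo_right hx.2.le).eventuallyLE

theorem integrable_primitive {L : ℝ} {v : ℝ → ℂ} (hv : Integrable v (intervalMeasure L)) :
    Integrable (fun x => ∫ y in Ioo 0 x, v y) (intervalMeasure L) :=
  (memLp_primitive hv).integrable (by norm_num)

/-- Integration by parts of an `H¹` function against a `C¹` function vanishing at both ends. -/
theorem IsWeakDeriv.integral_mul {L : ℝ} (hL : 0 < L) {u v : L2 L} (h : IsWeakDeriv L u v)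
    {z z' : ℝ → ℂ} (hz : ∀ x, HasDerivAt z (z' x) x) (hz' : Continuous z')
    (hz0 : z 0 = 0) (hzL : z L = 0) :
    ∫ x in Ioo 0 L, v x * z x = -∫ x in Ioo 0 L, u x * z' x := by
  set V : ℝ → ℂ := fun x => ∫ y in Ioo 0 x, v y with hV
  have hVi : Integrable V (intervalMeasure L) := integrable_primitive v.integrable
  -- The difference of `u` and the primitive of `v` has zero weak derivative, hence is constant. The
  -- constant then drops out because `∫ z' = z(L) - z(0) = 0`.
  obtain ⟨c, hc⟩ := ae_eq_const_of_integral_deriv_smul_eq_zero hL (w := fun x => u x - V x)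
    (u.integrable.sub hVi) (by
      intro φ h1 h2 h3
      have hφL : φ L = 0 := by
        by_contra hne
        exact lt_irrefl _ (h3 (subset_tsupport _ hne)).2
      have hd : Continuous (deriv φ) := h1.continuous_deriv (by simp)
      have e1 := integral_deriv_mul_primitive (L := L) (z := fun x => (φ x : ℂ))
        (z' := fun x => ((deriv φ x : ℝ) : ℂ)) (v := v)
        (fun x => ((h1.differentiable (by simp)).differentiableAt.hasDerivAt).ofReal_comp)
        (Complex.continuous_ofReal.comp hd) (by simp [hφL]) v.integrable
      simp only [smul_sub]
      have i2 : Integrable (fun x => deriv φ x • V x) (intervalMeasure L) := by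
        obtain ⟨C, hC⟩ := h2.deriv.exists_bound_of_continuous hd
        exact hVi.bdd_smul C hd.aestronglyMeasurable (Filter.Eventually.of_forall hC)
      rw [integral_sub (integrable_smul_test u hd h2.deriv) i2, h φ h1 h2 h3]
      simp only [Complex.real_smul, hV]
      rw [e1]; ring)
  have e1 := integral_deriv_mul_primitive hz hz' hzL v.integrable
  have e2 : ∫ x in Ioo 0 L, u x * z' x = ∫ x in Ioo 0 L, (c * z' x + z' x * V x) := by
    apply integral_congr_ae
    filter_upwards [hc] with x hx
    rw [← hx]; ring
  have e3 : ∫ x in Ioo 0 L, z' x = 0 := by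
    rw [setIntegral_Ioo_eq hL.le, intervalIntegral.integral_eq_sub_of_hasDerivAt
      (fun x _ => hz x) (hz'.intervalIntegrable _ _), hz0, hzL, sub_zero]
  rw [e2, integral_add ((integrable_of_continuous L hz').const_mul c), integral_const_mul, e3, e1]
  · simp [mul_comm]
  · simpa [mul_comm] using integrable_mul_continuous hVi hz'

theorem isWeakDeriv_of_hasDerivAt {L : ℝ} (hL : 0 < L) {u v : ℝ → ℂ}
    (h : ∀ x, HasDerivAt u (v x) x) (hu : Continuous u) (hv : Continuous v) :
    IsWeakDeriv L (ofContinuous L u hu) (ofContinuous L v hv) := by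
  intro φ h1 h2 h3
  have hφ : ∀ x, x ∉ Ioo 0 L → φ x = 0 := by
    intro x hx
    by_contra hne
    exact hx (h3 (subset_tsupport _ hne))
  have hd : Continuous (deriv φ) := h1.continuous_deriv (by simp)
  have e1 : ∫ x in Ioo 0 L, deriv φ x • (ofContinuous L u hu) x
      = ∫ x in (0 : ℝ)..L, ((deriv φ x : ℝ) : ℂ) * u x := by
    rw [← setIntegral_Ioo_eq hL.le]
    apply integral_congr_ae
    filter_upwards [coeFn_ofContinuous L hu] with x hx
    rw [hx, Complex.real_smul]
  have e2 : ∫ x in Ioo 0 L, φ x • (ofContinuous L v hv) x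
      = ∫ x in (0 : ℝ)..L, (φ x : ℂ) * v x := by
    rw [← setIntegral_Ioo_eq hL.le]
    apply integral_congr_ae
    filter_upwards [coeFn_ofContinuous L hv] with x hx
    rw [hx, Complex.real_smul]
  have e3 := intervalIntegral.integral_mul_deriv_eq_deriv_mul (a := 0) (b := L)
    (u := fun x => (φ x : ℂ)) (u' := fun x => ((deriv φ x : ℝ) : ℂ)) (v := u) (v' := v)
    (fun x _ => ((h1.differentiable (by simp)).differentiableAt.hasDerivAt).ofReal_comp)
    (fun x _ => h x) ((Complex.continuous_ofReal.comp hd).intervalIntegrable _ _)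
    (hv.intervalIntegrable _ _)
  rw [e1, e2, e3, hφ 0 (by simp), hφ L (by simp)]
  simp

theorem mem_domA_ofContinuous {L : ℝ} (hL : 0 < L) {u v : ℝ → ℂ}
    (h : ∀ x, HasDerivAt u (v x) x) (hu : Continuous u) (hv : Continuous v) (huL : u L = 0) :
    ofContinuous L u hu ∈ domA L :=
  ⟨⟨_, isWeakDeriv_of_hasDerivAt hL h hu hv⟩, u, hu.continuousOn, coeFn_ofContinuous L hu, huL⟩

/-- Density gives the `LinearPMap` adjoint its meaning. It holds because real test functions
supported in `(0, L)` lie in the domain, and nothing nonzero is orthogonal to all of them. -/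
theorem dense_domA {L : ℝ} (hL : 0 < L) : Dense (domA L : Set (L2 L)) := by
  rw [Submodule.dense_iff_topologicalClosure_eq_top, Submodule.topologicalClosure_eq_top_iff,
    Submodule.eq_bot_iff]
  intro z hz
  rw [Submodule.mem_orthogonal'] at hz
  have key : ∀ᵐ x, x ∈ Ioo 0 L → conj (z x) = 0 := by
    refine isOpen_Ioo.ae_eq_zero_of_integral_contDiff_smul_eq_zero ?_ ?_
    · have h3 : IntegrableOn (fun x => (z x : ℂ)) (Ioo 0 L) volume := z.integrable
      have h4 : IntegrableOn (fun x => conj (z x : ℂ)) (Ioo 0 L) volume :=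
        Complex.conjCLE.toContinuousLinearMap.integrable_comp h3
      exact h4.locallyIntegrableOn
    · intro φ h1 h2 h3
      have hφ : ∀ x, x ∉ Ioo 0 L → φ x = 0 := by
        intro x hx
        by_contra hne
        exact hx (h3 (subset_tsupport _ hne))
      have hd : Continuous (deriv φ) := h1.continuous_deriv (by simp)
      have hc : Continuous fun x => (φ x : ℂ) := Complex.continuous_ofReal.comp h1.continuous
      have := hz _ (mem_domA_ofContinuous hL (u := fun x => (φ x : ℂ))
        (fun x => ((h1.differentiable (by simp)).differentiableAt.hasDerivAt).ofReal_comp)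
        hc (Complex.continuous_ofReal.comp hd) (by simp [hφ L]))
      rw [inner_eq_integral] at this
      rw [← setIntegral_eq_integral_of_forall_compl_eq_zero (s := Ioo 0 L)
        (fun x hx => by simp [hφ x hx]), ← this]
      apply integral_congr_ae
      filter_upwards [coeFn_ofContinuous L hc] with x hx
      rw [hx, Complex.real_smul]
  have := (ae_restrict_iff' (μ := volume) (measurableSet_Ioo (a := (0 : ℝ)) (b := L))).2 key
  apply Lp.ext
  filter_upwards [this, Lp.coeFn_zero ℂ 2 (intervalMeasure L)] with x hx h0
  rw [h0]
  simpa using hx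

/-! ### The profile `∫₀ˣ exp (-l s) ds` -/

/-- The solution `x ↦ ∫₀ˣ exp (-l s) ds` of `z' + l z = 1`, `z(0) = 0`. -/
def expPrimitive (l : ℂ) (x : ℝ) : ℂ := ∫ s in (0 : ℝ)..x, Complex.exp (-l * s)

theorem continuous_exp_mul (l : ℂ) : Continuous fun x : ℝ => Complex.exp (-l * x) := by fun_prop

theorem hasDerivAt_expPrimitive (l : ℂ) (x : ℝ) :
    HasDerivAt (expPrimitive l) (Complex.exp (-l * x)) x :=
  intervalIntegral.integral_hasDerivAt_right ((continuous_exp_mul l).intervalIntegrable _ _)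
    ((continuous_exp_mul l).stronglyMeasurableAtFilter _ _) (continuous_exp_mul l).continuousAt

theorem continuous_expPrimitive (l : ℂ) : Continuous (expPrimitive l) :=
  continuous_iff_continuousAt.2 fun x => (hasDerivAt_expPrimitive l x).continuousAt

theorem contDiff_expPrimitive (l : ℂ) : ContDiff ℝ 1 (expPrimitive l) := by
  rw [contDiff_one_iff_deriv]
  refine ⟨fun x => (hasDerivAt_expPrimitive l x).differentiableAt, ?_⟩
  rw [funext fun x => (hasDerivAt_expPrimitive l x).deriv]
  exact continuous_exp_mul l

@[simp]
theorem expPrimitive_zero_right (l : ℂ) : expPrimitive l 0 = 0 := by simp [expPrimitive]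

/-- The equation `z' + l z = 1` in integrated form. Unlike the closed formula with a division by
`l`, it includes `l = 0`. -/
theorem mul_expPrimitive (l : ℂ) (x : ℝ) :
    l * expPrimitive l x = 1 - Complex.exp (-l * x) := by
  by_cases hl : l = 0
  · simp [hl]
  · rw [expPrimitive, integral_exp_mul_complex (neg_ne_zero.2 hl)]
    field_simp
    simp

theorem conj_expPrimitive (l : ℂ) (x : ℝ) :
    conj (expPrimitive l x) = expPrimitive (conj l) x := by
  have h := Complex.conjCLE.toContinuousLinearMap.intervalIntegral_comp_comm
    ((continuous_exp_mul l).intervalIntegrable (μ := volume) 0 x)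
  refine h.symm.trans (intervalIntegral.integral_congr fun s _ => ?_)
  change conj (Complex.exp (-l * s)) = _
  rw [← Complex.exp_conj]; simp

/-- No nonzero eigenfunction of `A*` vanishes at `L`, expressed on the eigenfunctions
`expPrimitive l` that `A*` can have. -/
def Nonresonant (L : ℝ) (g : L2 L) : Prop :=
  ∀ l : ℂ, expPrimitive l L = 0 → ∫ x in Ioo 0 L, g x * conj (expPrimitive l x) ≠ 1

/-! ### The operators for a kernel depending on the first variable -/

section Kernel

variable {L : ℝ} {G : Kernel2 L} {g : L2 L}

theorem kernel_ae_right (hG : ∀ᵐ p ∂(squareMeasure L), G p = g p.1) :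
    ∀ᵐ x ∂(intervalMeasure L), ∀ᵐ y ∂(intervalMeasure L), G (x, y) = g x :=
  Measure.ae_ae_of_ae_prod hG

theorem kernel_ae_left (hG : ∀ᵐ p ∂(squareMeasure L), G p = g p.1) :
    ∀ᵐ x ∂(intervalMeasure L), ∀ᵐ y ∂(intervalMeasure L), G (y, x) = g y := by
  have h : ∀ᵐ p ∂(squareMeasure L), G p.swap = g p.2 :=
    (Measure.measurePreserving_swap (μ := intervalMeasure L)
      (ν := intervalMeasure L)).quasiMeasurePreserving.ae hG
  exact Measure.ae_ae_of_ae_prod h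

/-- The perturbation has rank one: it sees `u` only through its mean. -/
theorem coeFn_intOp (hG : ∀ᵐ p ∂(squareMeasure L), G p = g p.1) (u : L2 L) :
    intOp G u =ᵐ[intervalMeasure L] fun x => g x * ∫ y in Ioo 0 L, u y := by
  filter_upwards [(memLp_intOp G u).coeFn_toLp, kernel_ae_right hG] with x h1 h2
  change (memLp_intOp G u).toLp _ x = _
  rw [h1, ← integral_const_mul]
  apply integral_congr_ae
  filter_upwards [h2] with y hy
  rw [hy]

/-- `weakDeriv` is a choice; taking an arbitrary weak derivative `v` as input lets explicit
derivatives be used, by uniqueness. -/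
theorem inner_opA (hG : ∀ᵐ p ∂(squareMeasure L), G p = g p.1) (z : L2 L)
    (u : (opA G).domain) {v : L2 L} (hv : IsWeakDeriv L u v) :
    inner ℂ z (opA G u) = (∫ x in Ioo 0 L, v x * conj (z x))
      + (∫ x in Ioo 0 L, (u : L2 L) x) * ∫ x in Ioo 0 L, g x * conj (z x) := by
  have h : opA G u = v + intOp G u := by
    rw [hv.unique (weakDeriv_spec u)]; rfl
  rw [h, inner_add_right, inner_eq_integral, inner_eq_integral, ← integral_const_mul]
  congr 1
  apply integral_congr_ae
  filter_upwards [coeFn_intOp hG (u : L2 L)] with x hx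
  rw [hx]; ring

/-- The formula for `A*` is never computed. The duality `conj l ⟪z, u⟫ = ⟪z, A u⟫` is tested on
solutions `u` of `u' - conj l u = f`, `u(L) = 0`, for arbitrary `f`, which identifies `z` as `conj
d` times `E_l`. -/
theorem fattorini_of_nonresonant (hL : 0 < L) (hG : ∀ᵐ p ∂(squareMeasure L), G p = g p.1)
    (h : Nonresonant L g) : FattoriniCriterion G := by
  intro l
  refine Subset.antisymm ?_ ?_
  · rintro z ⟨⟨hz, hlz⟩, -, w, hwc, hwz, hwL⟩
    set d : ℂ := ∫ x in Ioo 0 L, g x * conj (z x) with hd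
    have hdense : Dense ((opA G).domain : Set (L2 L)) := dense_domA hL
    have hadj : ∀ u : (opA G).domain, conj l * inner ℂ z (u : L2 L) = inner ℂ z (opA G u) := by
      intro u
      have e1 : inner ℂ (adjA G ⟨z, hz⟩) (u : L2 L) = inner ℂ z (opA G u) :=
        LinearPMap.adjoint_isFormalAdjoint hdense ⟨z, hz⟩ u
      rw [← e1, ← sub_eq_zero.1 hlz, inner_smul_left]
    have key : ∀ᵐ x, x ∈ Ioo 0 L → conj (z x) - d * conj (expPrimitive l x) = 0 := by
      have hEc : Continuous fun x => conj (expPrimitive l x) :=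
        Complex.continuous_conj.comp (continuous_expPrimitive l)
      have hzi : Integrable (fun x => conj (z x)) (intervalMeasure L) :=
        Complex.conjCLE.toContinuousLinearMap.integrable_comp z.integrable
      have hEi : Integrable (fun x => d * conj (expPrimitive l x)) (intervalMeasure L) :=
        (integrable_of_continuous L hEc).const_mul d
      refine isOpen_Ioo.ae_eq_zero_of_integral_contDiff_smul_eq_zero ?_ ?_
      · have h3 : IntegrableOn (fun x => conj (z x) - d * conj (expPrimitive l x)) (Ioo 0 L) :=
          hzi.sub hEi
        exact h3.locallyIntegrableOn
      intro f h1 h2 h3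
      set f' : ℝ → ℂ := fun x => (f x : ℂ) with hf'
      have hf0 : ∀ x, x ∉ Ioo 0 L → f x = 0 := by
        intro x hx
        by_contra hne
        exact hx (h3 (subset_tsupport _ hne))
      have hfc : Continuous f' := Complex.continuous_ofReal.comp h1.continuous
      have hk : Continuous fun y : ℝ => Complex.exp (-conj l * y) * f' y :=
        (continuous_exp_mul _).mul hfc
      -- Variation of constants started at `L`, so that `u(L) = 0` and `u` lies in the domain of
      -- `A`.
      set u : ℝ → ℂ := fun x => Complex.exp (conj l * x) *
        ∫ y in L..x, Complex.exp (-conj l * y) * f' y with hu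
      have hexp : ∀ x : ℝ, Complex.exp (conj l * x) * Complex.exp (-conj l * x) = 1 := by
        intro x; rw [← Complex.exp_add]; simp
      have hud : ∀ x, HasDerivAt u (conj l * u x + f' x) x := by
        intro x
        have d1 : HasDerivAt (fun x : ℝ => Complex.exp (conj l * x))
            (Complex.exp (conj l * x) * conj l) x := by
          have : HasDerivAt (fun x : ℝ => conj l * (x : ℂ)) (conj l) x := by
            simpa using (Complex.ofRealCLM.hasDerivAt (x := x)).const_mul (conj l)
          exact this.cexp
        have d2 : HasDerivAt (fun x => ∫ y in L..x, Complex.exp (-conj l * y) * f' y)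
            (Complex.exp (-conj l * x) * f' x) x :=
          intervalIntegral.integral_hasDerivAt_right (hk.intervalIntegrable _ _)
            (hk.stronglyMeasurableAtFilter _ _) hk.continuousAt
        refine (d1.mul d2).congr_deriv ?_
        rw [← mul_assoc, hexp, hu]; ring
      have huc : Continuous u := continuous_iff_continuousAt.2 fun x => (hud x).continuousAt
      have huL : u L = 0 := by simp [hu]
      have hvc : Continuous fun x => conj l * u x + f' x := by fun_prop
      -- Integrate `(u conj E_l)'`: the boundary terms vanish, and `conj l · conj E_l + exp (-conj l
      -- x) = 1` leaves the mean of `u`.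
      have hint : ∫ x in Ioo 0 L, u x = -∫ x in Ioo 0 L, f' x * conj (expPrimitive l x) := by
        have hpd : ∀ x : ℝ, HasDerivAt (fun x => conj (expPrimitive l x))
            (Complex.exp (-conj l * x)) x := by
          intro x
          simp only [conj_expPrimitive]
          exact hasDerivAt_expPrimitive _ x
        have ibp := intervalIntegral.integral_deriv_mul_eq_sub (a := 0) (b := L)
          (fun x _ => hud x) (fun x _ => hpd x)
          (hvc.intervalIntegrable _ _) ((continuous_exp_mul _).intervalIntegrable _ _)
        rw [huL] at ibp
        have e : ∀ x : ℝ, (conj l * u x + f' x) * conj (expPrimitive l x)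
            + u x * Complex.exp (-conj l * x) = f' x * conj (expPrimitive l x) + u x := by
          intro x
          have := mul_expPrimitive (conj l) x
          rw [← conj_expPrimitive] at this
          linear_combination u x * this
        simp only [e] at ibp
        rw [intervalIntegral.integral_add
          ((show Continuous fun x => f' x * conj (expPrimitive l x) from
            hfc.mul hEc).intervalIntegrable _ _)
          (huc.intervalIntegrable _ _)] at ibp
        rw [setIntegral_Ioo_eq hL.le, setIntegral_Ioo_eq hL.le]
        simp at ibp
        linear_combination ibp
      have hmem := mem_domA_ofContinuous hL hud huc hvc huL
      have e1 := hadj ⟨_, hmem⟩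
      rw [inner_opA hG z ⟨_, hmem⟩ (isWeakDeriv_of_hasDerivAt hL hud huc hvc), ← hd,
        inner_eq_integral] at e1
      have a1 : ∫ x in Ioo 0 L, (ofContinuous L u huc) x * conj (z x)
          = ∫ x in Ioo 0 L, conj (z x) * u x := by
        apply integral_congr_ae
        filter_upwards [coeFn_ofContinuous L huc] with x hx
        rw [hx, mul_comm]
      have a2 : ∫ x in Ioo 0 L, (ofContinuous L _ hvc) x * conj (z x)
          = conj l * (∫ x in Ioo 0 L, conj (z x) * u x) + ∫ x in Ioo 0 L, f' x * conj (z x) := by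
        rw [← integral_const_mul, ← integral_add]
        · apply integral_congr_ae
          filter_upwards [coeFn_ofContinuous L hvc] with x hx
          rw [hx]; ring
        · exact (integrable_mul_continuous hzi huc).const_mul _
        · simpa [mul_comm] using integrable_mul_continuous hzi hfc
      have a3 : ∫ x in Ioo 0 L, (ofContinuous L u huc) x = ∫ x in Ioo 0 L, u x :=
        integral_congr_ae (coeFn_ofContinuous L huc)
      simp only at e1
      rw [a1, a2, a3, hint] at e1
      have e2 : ∫ x in Ioo 0 L, f x • (conj (z x) - d * conj (expPrimitive l x)) = 0 := by
        have : ∀ x, f x • (conj (z x) - d * conj (expPrimitive l x))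
            = f' x * conj (z x) - d * (f' x * conj (expPrimitive l x)) := by
          intro x; rw [Complex.real_smul]; ring
        simp only [this]
        rw [integral_sub, integral_const_mul]
        · linear_combination -e1
        · simpa [mul_comm] using integrable_mul_continuous hzi hfc
        · exact (integrable_of_continuous L (hfc.mul hEc)).const_mul d
      rw [← e2]
      symm
      apply setIntegral_eq_integral_of_forall_compl_eq_zero
      intro x hx
      simp [hf0 x hx]
    have hzE : ∀ᵐ x ∂(intervalMeasure L), conj (z x) = d * conj (expPrimitive l x) := by
      have := (ae_restrict_iff' (μ := volume) (measurableSet_Ioo (a := (0 : ℝ)) (b := L))).2 key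
      filter_upwards [this] with x hx
      exact sub_eq_zero.1 hx
    rw [mem_singleton_iff]
    by_cases hd0 : d = 0
    · apply Lp.ext
      filter_upwards [hzE, Lp.coeFn_zero ℂ 2 (intervalMeasure L)] with x hx h0
      rw [h0]
      simpa [hd0] using hx
    exfalso
    have hEL : expPrimitive l L = 0 := by
      -- The trace is that of some continuous representative; almost everywhere equal continuous
      -- functions agree up to the endpoint `L`.
      have hEqOn : EqOn w (fun x => conj d * expPrimitive l x) (Icc 0 L) := by
        have hcont : ContinuousOn (fun x => conj d * expPrimitive l x) (Icc 0 L) :=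
          (continuous_const.mul (continuous_expPrimitive l)).continuousOn
        refine Measure.eqOn_Icc_of_ae_eq volume hL.ne ?_ hwc hcont
        have : w =ᵐ[intervalMeasure L] fun x => conj d * expPrimitive l x := by
          filter_upwards [hwz, hzE] with x h1 h2
          have := congrArg conj h2
          simp only [Complex.conj_conj, map_mul] at this
          rw [← h1, this]
        rwa [intervalMeasure, Measure.restrict_congr_set Ioo_ae_eq_Icc] at this
      have := hEqOn (right_mem_Icc.2 hL.le)
      rw [hwL] at this
      simpa [hd0] using this.symm
    refine h l hEL ?_
    -- Self-consistency: insert the formula for `z` into the definition of `d`.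
    have : d = d * ∫ x in Ioo 0 L, g x * conj (expPrimitive l x) := by
      rw [← integral_const_mul]
      nth_rewrite 1 [hd]
      apply integral_congr_ae
      filter_upwards [hzE] with x hx
      rw [hx]; ring
    exact (mul_left_cancel₀ hd0 (by rw [mul_one]; exact this)).symm
  · rintro z rfl
    have h0 : (0 : L2 L) ∈ (adjA G).domain := zero_mem _
    refine ⟨⟨h0, ?_⟩, h0, HasTrace.zero L L⟩
    have : (⟨0, h0⟩ : (adjA G).domain) = 0 := rfl
    rw [this, LinearPMap.map_zero]; simp

/-- At a resonance `E_l` itself is an eigenfunction of `A*` in the kernel of `B*`. It is nonzero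
because its pairing with `g` equals `1`. -/
theorem nonresonant_of_fattorini (hL : 0 < L) (hG : ∀ᵐ p ∂(squareMeasure L), G p = g p.1)
    (h : FattoriniCriterion G) : Nonresonant L g := by
  intro l hEL hres
  set z := ofContinuous L _ (continuous_expPrimitive l) with hz
  have hzE : z =ᵐ[intervalMeasure L] expPrimitive l := coeFn_ofContinuous L _
  have hdense : Dense ((opA G).domain : Set (L2 L)) := dense_domA hL
  have hgz : ∫ x in Ioo 0 L, g x * conj (z x) = 1 := by
    rw [← hres]
    apply integral_congr_ae
    filter_upwards [hzE] with x hx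
    rw [hx]
  have key : ∀ u : (opA G).domain, inner ℂ (l • z) (u : L2 L) = inner ℂ z (opA G u) := by
    intro u
    have hpd : ∀ x : ℝ, HasDerivAt (fun x => conj (expPrimitive l x))
        (Complex.exp (-conj l * x)) x := by
      intro x
      simp only [conj_expPrimitive]
      exact hasDerivAt_expPrimitive _ x
    have hEc : Continuous fun x => conj (expPrimitive l x) :=
      Complex.continuous_conj.comp (continuous_expPrimitive l)
    have hw := weakDeriv_spec u
    rw [inner_opA hG z u hw, hgz, mul_one, inner_smul_left, inner_eq_integral]
    have a1 : ∫ x in Ioo 0 L, (u : L2 L) x * conj (z x)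
        = ∫ x in Ioo 0 L, (u : L2 L) x * conj (expPrimitive l x) := by
      apply integral_congr_ae
      filter_upwards [hzE] with x hx
      rw [hx]
    have a2 : ∫ x in Ioo 0 L, (weakDeriv L u) x * conj (z x)
        = ∫ x in Ioo 0 L, (weakDeriv L u) x * conj (expPrimitive l x) := by
      apply integral_congr_ae
      filter_upwards [hzE] with x hx
      rw [hx]
    rw [a1, a2, hw.integral_mul hL hpd (continuous_exp_mul _) (by simp) (by simp [hEL]),
      ← integral_const_mul, neg_add_eq_sub, ← integral_sub (u : L2 L).integrable
        (integrable_mul_continuous (u : L2 L).integrable (continuous_exp_mul _))]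
    congr 1; ext x
    have := mul_expPrimitive (conj l) x
    rw [← conj_expPrimitive] at this
    linear_combination (u : L2 L) x * this
  have hmem : z ∈ (adjA G).domain :=
    LinearPMap.mem_adjoint_domain_of_exists z ⟨l • z, key⟩
  have hadj : adjA G ⟨z, hmem⟩ = l • z :=
    LinearPMap.adjoint_apply_eq hdense ⟨z, hmem⟩ key
  have hz0 : z ∈ kerAdjA G l ∩ kerAdjB G :=
    ⟨⟨hmem, by rw [hadj, sub_self]⟩, hmem, _, (continuous_expPrimitive l).continuousOn, hzE, hEL⟩
  rw [h l, mem_singleton_iff] at hz0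
  rw [hz0] at hgz
  have : ∫ x in Ioo 0 L, g x * conj ((0 : L2 L) x) = 0 := by
    apply integral_eq_zero_of_ae
    filter_upwards [Lp.coeFn_zero ℂ 2 (intervalMeasure L)] with x hx
    rw [hx]; simp
  rw [this] at hgz
  exact zero_ne_one hgz

/-- At a resonance `φ(t, x) = exp (-l t) E_l(x)` annihilates the bulk term and, vanishing at `x =
L`, the control term as well. Steering `0` to `E_l` would then give `‖E_l‖² = 0`. -/
theorem nonresonant_of_exactlyControllable {T : ℝ} (hT : 0 ≤ T)
    (hG : ∀ᵐ p ∂(squareMeasure L), G p = g p.1)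
    (h : ExactlyControllable L G T) : Nonresonant L g := by
  intro l hEL hres
  set z := ofContinuous L _ (continuous_expPrimitive l) with hz
  have hzE : z =ᵐ[intervalMeasure L] expPrimitive l := coeFn_ofContinuous L _
  obtain ⟨U, u, hu, huT⟩ := h 0 z
  have hφ : ContDiff ℝ 1 fun p : ℝ × ℝ => Complex.exp (-l * p.1) * expPrimitive l p.2 := by
    refine ContDiff.mul ?_ ((contDiff_expPrimitive l).comp contDiff_snd)
    exact (contDiff_const.mul (Complex.ofRealCLM.contDiff.comp contDiff_fst)).cexp
  have hw := hu.weak_eq T ⟨hT, le_rfl⟩ _ hφ (by simp)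
  have hgc : ∫ y in Ioo 0 L, conj (g y) * expPrimitive l y = 1 := by
    have := congrArg conj hres
    rw [← integral_conj] at this
    simpa using this
  have e1 : ∫ t in Ioo 0 T, ∫ x in Ioo 0 L, u t x *
      conj (-deriv (fun s : ℝ => Complex.exp (-l * s) * expPrimitive l x) t
        + deriv (fun y : ℝ => Complex.exp (-l * t) * expPrimitive l y) x
        - ∫ y in Ioo 0 L, conj (G (y, x)) * (Complex.exp (-l * t) * expPrimitive l y)) = 0 := by
    refine integral_eq_zero_of_ae (Filter.Eventually.of_forall fun t => ?_)
    refine integral_eq_zero_of_ae ?_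
    filter_upwards [kernel_ae_left hG] with x hx
    have d1 : deriv (fun s : ℝ => Complex.exp (-l * s) * expPrimitive l x) t
        = Complex.exp (-l * t) * -l * expPrimitive l x := by
      have : HasDerivAt (fun x : ℝ => -l * (x : ℂ)) (-l) t := by
        simpa using (Complex.ofRealCLM.hasDerivAt (x := t)).const_mul (-l)
      exact (this.cexp.mul_const _).deriv
    have d2 : deriv (fun y : ℝ => Complex.exp (-l * t) * expPrimitive l y) x
        = Complex.exp (-l * t) * Complex.exp (-l * x) :=
      ((hasDerivAt_expPrimitive l x).const_mul _).deriv
    have d3 : ∫ y in Ioo 0 L, conj (G (y, x)) * (Complex.exp (-l * t) * expPrimitive l y)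
        = Complex.exp (-l * t) := by
      trans ∫ y in Ioo 0 L, Complex.exp (-l * t) * (conj (g y) * expPrimitive l y)
      swap
      · rw [integral_const_mul, hgc, mul_one]
      apply integral_congr_ae
      filter_upwards [hx] with y hy
      rw [hy]; ring
    rw [d1, d2, d3]
    have : -(Complex.exp (-l * t) * -l * expPrimitive l x)
        + Complex.exp (-l * t) * Complex.exp (-l * x) - Complex.exp (-l * t) = 0 := by
      linear_combination Complex.exp (-l * t) * mul_expPrimitive l x
    rw [this]; simp
  have e2 : ∫ x in Ioo 0 L, (0 : L2 L) x
      * conj (Complex.exp (-l * (0 : ℝ)) * expPrimitive l x) = 0 := by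
    apply integral_eq_zero_of_ae
    filter_upwards [Lp.coeFn_zero ℂ 2 (intervalMeasure L)] with x hx
    rw [hx]; simp
  have e3 : ∫ x in Ioo 0 L, u T x * conj (Complex.exp (-l * T) * expPrimitive l x)
      = conj (Complex.exp (-l * T)) * inner ℂ z z := by
    rw [inner_eq_integral, ← integral_const_mul, huT]
    apply integral_congr_ae
    filter_upwards [hzE] with x hx
    rw [hx, map_mul]; ring
  simp only [hEL, mul_zero, map_zero, integral_zero, sub_zero] at hw
  rw [e1, e2, e3, zero_add, sub_zero, mul_eq_zero, inner_self_eq_zero] at hw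
  rcases hw with hw | hw
  · simp at hw
  · refine zero_ne_one (α := ℂ) ?_
    rw [← hres]
    symm
    apply integral_eq_zero_of_ae
    have h0 : z =ᵐ[intervalMeasure L] (0 : ℝ → ℂ) := by rw [hw]; exact Lp.coeFn_zero _ _ _
    filter_upwards [hzE, h0] with x hx h1
    rw [← hx, h1]; simp

end Kernel

/-! ### The transport equation along characteristics -/

/-- The conjugate of `-φ_t + φ_x`. -/
def transportSymbol (φ : ℝ × ℝ → ℂ) (t x : ℝ) : ℂ :=
  conj (-deriv (fun s => φ (s, x)) t + deriv (fun y => φ (t, y)) x)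

theorem transportSymbol_eq_fderiv {φ : ℝ × ℝ → ℂ} (hφ : ContDiff ℝ 1 φ) (t x : ℝ) :
    transportSymbol φ t x = conj (fderiv ℝ φ (t, x) (-1, 1)) := by
  have hd : HasFDerivAt φ (fderiv ℝ φ (t, x)) (t, x) :=
    ((hφ.differentiable (by simp)) (t, x)).hasFDerivAt
  have h1 : HasDerivAt (fun s => φ (s, x)) (fderiv ℝ φ (t, x) (1, 0)) t :=
    hd.comp_hasDerivAt t ((hasDerivAt_id t).prodMk (hasDerivAt_const t x))
  have h2 : HasDerivAt (fun y => φ (t, y)) (fderiv ℝ φ (t, x) (0, 1)) x :=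
    hd.comp_hasDerivAt x ((hasDerivAt_const x t).prodMk (hasDerivAt_id x))
  have h3 : fderiv ℝ φ (t, x) (-1, 1) = -fderiv ℝ φ (t, x) (1, 0) + fderiv ℝ φ (t, x) (0, 1) := by
    rw [← map_neg, ← map_add]; simp
  rw [transportSymbol, h1.deriv, h2.deriv, h3]

theorem continuous_transportSymbol {φ : ℝ × ℝ → ℂ} (hφ : ContDiff ℝ 1 φ) :
    Continuous fun p : ℝ × ℝ => transportSymbol φ p.1 p.2 := by
  simp only [transportSymbol_eq_fderiv hφ]
  exact Complex.continuous_conj.comp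
    ((hφ.continuous_fderiv (by simp)).clm_apply continuous_const)

/-- Increasing `t` along the characteristic `x + t = ξ` moves in direction `(1, -1)`, opposite to
the direction `(-1, 1)` of the symbol; hence the sign. -/
theorem hasDerivAt_characteristic {φ : ℝ × ℝ → ℂ} (hφ : ContDiff ℝ 1 φ) (ξ t : ℝ) :
    HasDerivAt (fun t => conj (φ (t, ξ - t))) (-transportSymbol φ t (ξ - t)) t := by
  have hd : HasFDerivAt φ (fderiv ℝ φ (t, ξ - t)) (t, ξ - t) :=
    ((hφ.differentiable (by simp)) _).hasFDerivAt
  have h1 : HasDerivAt (fun t => φ (t, ξ - t)) (fderiv ℝ φ (t, ξ - t) (1, -1)) t :=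
    HasFDerivAt.comp_hasDerivAt (f := fun t => (t, ξ - t)) t hd
      ((hasDerivAt_id t).prodMk ((hasDerivAt_id t).const_sub ξ))
  have h2 := Complex.conjCLE.toContinuousLinearMap.hasFDerivAt.comp_hasDerivAt t h1
  refine h2.congr_deriv ?_
  have h3 : ((1, -1) : ℝ × ℝ) = -(-1, 1) := by simp
  rw [transportSymbol_eq_fderiv hφ, h3, map_neg]
  exact map_neg _ _

theorem setIntegral_Ioo_comp_add {F : ℝ → ℂ} (a b t : ℝ) :
    ∫ x in Ioo a b, F (x + t) = ∫ x in Ioo (a + t) (b + t), F x := by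
  rw [← integral_indicator measurableSet_Ioo, ← integral_indicator measurableSet_Ioo,
    ← integral_add_right_eq_self ((Ioo (a + t) (b + t)).indicator F) t]
  congr 1; ext x
  simp [indicator]

/-- The fundamental theorem of calculus on the part of `x + t = ξ` inside the rectangle. It enters
at `t = 0` if `ξ < L` and at `x = L` if `ξ > L`; it leaves at `t = τ` if `ξ > τ` and otherwise at `x
= 0`, where `φ` vanishes. The excluded values of `ξ` are those of lines through the corners, a null
set. -/
theorem setIntegral_transportSymbol_characteristic {L τ : ℝ} (hL : 0 < L) (hτ : 0 ≤ τ)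
    {φ : ℝ × ℝ → ℂ} (hφ : ContDiff ℝ 1 φ) (hφ0 : ∀ t ∈ Icc 0 τ, φ (t, 0) = 0) {ξ : ℝ}
    (h0 : ξ ≠ 0) (h1 : ξ ≠ L) (h2 : ξ ≠ τ) (h3 : ξ ≠ L + τ) :
    ∫ t in Ioo 0 τ ∩ Ioo (ξ - L) ξ, transportSymbol φ t (ξ - t)
      = (Ioo 0 L).indicator (fun ξ => conj (φ (0, ξ))) ξ
        + (Ioo L (L + τ)).indicator (fun ξ => conj (φ (ξ - L, L))) ξ
        - (Ioo τ (L + τ)).indicator (fun ξ => conj (φ (τ, ξ - τ))) ξ := by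
  rw [Ioo_inter_Ioo]
  by_cases hξ : ξ < 0 ∨ L + τ < ξ
  · have hempty : Ioo (max 0 (ξ - L)) (min τ ξ) = ∅ := by
      apply Ioo_eq_empty
      rw [not_lt]
      rcases hξ with hξ | hξ
      · exact (min_le_right _ _).trans (hξ.le.trans (le_max_left _ _))
      · exact (min_le_left _ _).trans ((by linarith : τ ≤ ξ - L).trans (le_max_right _ _))
    rw [hempty, setIntegral_empty, indicator_of_notMem, indicator_of_notMem, indicator_of_notMem]
    · simp
    all_goals
      rintro ⟨h4, h5⟩
      rcases hξ with hξ | hξ <;> linarith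
  rw [not_or, not_lt, not_lt] at hξ
  obtain ⟨hξ0, hξ1⟩ := hξ
  have hξ0 : 0 < ξ := lt_of_le_of_ne hξ0 h0.symm
  have hξ1 : ξ < L + τ := lt_of_le_of_ne hξ1 h3
  have hab : max 0 (ξ - L) ≤ min τ ξ :=
    max_le (le_min hτ hξ0.le) (le_min (by linarith) (by linarith))
  have hcont : Continuous fun t => transportSymbol φ t (ξ - t) :=
    (continuous_transportSymbol hφ).comp (continuous_id.prodMk (continuous_const.sub continuous_id))
  have ftc := intervalIntegral.integral_eq_sub_of_hasDerivAt (a := max 0 (ξ - L)) (b := min τ ξ)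
    (fun t _ => hasDerivAt_characteristic hφ ξ t) (hcont.neg.intervalIntegrable _ _)
  rw [intervalIntegral.integral_neg] at ftc
  rw [← integral_Ioc_eq_integral_Ioo, ← intervalIntegral.integral_of_le hab,
    neg_eq_iff_eq_neg.1 ftc, neg_sub]
  congr 1
  · rcases lt_or_gt_of_ne h1 with h | h
    · rw [max_eq_left (by linarith), indicator_of_mem (by exact ⟨hξ0, h⟩),
        indicator_of_notMem (by rintro ⟨h4, -⟩; linarith)]
      simp
    · rw [max_eq_right (by linarith), indicator_of_notMem (by rintro ⟨-, h4⟩; linarith),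
        indicator_of_mem (by exact ⟨h, hξ1⟩)]
      simp
  · rcases lt_or_gt_of_ne h2 with h | h
    · rw [min_eq_right h.le, indicator_of_notMem (by rintro ⟨h4, -⟩; linarith), sub_self,
        hφ0 ξ ⟨hξ0.le, h.le⟩, map_zero]
    · rw [min_eq_left h.le, indicator_of_mem (by exact ⟨h, hξ1⟩)]

/-- Left translations of an integrable function satisfy the weak form of `u_t = u_x`. -/
theorem integral_transport {L τ : ℝ} (hL : 0 < L) (hτ : 0 ≤ τ) {f : ℝ → ℂ} (hf : Integrable f)
    {φ : ℝ × ℝ → ℂ} (hφ : ContDiff ℝ 1 φ) (hφ0 : ∀ t ∈ Icc 0 τ, φ (t, 0) = 0) :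
    ∫ t in Ioo 0 τ, ∫ x in Ioo 0 L, f (x + t) * transportSymbol φ t x
      = (∫ x in Ioo 0 L, f x * conj (φ (0, x))) + (∫ t in Ioo 0 τ, f (t + L) * conj (φ (t, L)))
        - ∫ x in Ioo 0 L, f (x + τ) * conj (φ (τ, x)) := by
  -- The rectangle in the coordinates `(t, ξ)` with `ξ = x + t`; Fubini then integrates along
  -- characteristics first.
  set S : Set (ℝ × ℝ) := {p | (0 < p.1 ∧ p.1 < τ) ∧ (p.1 < p.2 ∧ p.2 < p.1 + L)} with hS
  have hSm : MeasurableSet S :=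
    ((measurableSet_lt measurable_const measurable_fst).inter
      (measurableSet_lt measurable_fst measurable_const)).inter
    ((measurableSet_lt measurable_fst measurable_snd).inter
      (measurableSet_lt measurable_snd (measurable_fst.add_const L)))
  set m : ℝ × ℝ → ℂ := S.indicator fun p => transportSymbol φ p.1 (p.2 - p.1) with hm
  have hcont : Continuous fun p : ℝ × ℝ => transportSymbol φ p.1 (p.2 - p.1) :=
    (continuous_transportSymbol hφ).comp
      (continuous_fst.prodMk (continuous_snd.sub continuous_fst))
  obtain ⟨C, hC⟩ := (isCompact_Icc (a := (0 : ℝ)) (b := τ)).prod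
    (isCompact_Icc (a := (0 : ℝ)) (b := L)) |>.exists_bound_of_continuousOn
    (continuous_transportSymbol hφ).continuousOn
  have hint : Integrable (fun p : ℝ × ℝ => f p.2 * m p)
      ((volume.restrict (Ioo 0 τ)).prod volume) := by
    refine (hf.comp_snd (volume.restrict (Ioo 0 τ))).mul_bdd (c := max C 0)
      (hcont.measurable.indicator hSm).aestronglyMeasurable (Filter.Eventually.of_forall fun p => ?_)
    by_cases hp : p ∈ S
    · rw [hm, indicator_of_mem hp]
      refine le_max_of_le_left (hC (p.1, p.2 - p.1) ?_)
      obtain ⟨⟨p1, p2⟩, p3, p4⟩ := hp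
      exact ⟨⟨p1.le, p2.le⟩, by simp only; linarith, by simp only; linarith⟩
    · rw [hm, indicator_of_notMem hp]; simp
  have hswap := integral_integral_swap (f := fun t ξ => f ξ * m (t, ξ)) hint
  have e1 : ∀ t ∈ Ioo 0 τ, ∫ x in Ioo 0 L, f (x + t) * transportSymbol φ t x
      = ∫ ξ, f ξ * m (t, ξ) := by
    intro t ht
    have := setIntegral_Ioo_comp_add (F := fun ξ => f ξ * transportSymbol φ t (ξ - t)) 0 L t
    simp only [add_sub_cancel_right] at this
    rw [this, ← integral_indicator measurableSet_Ioo]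
    congr 1; ext ξ
    simp only [hm, indicator, hS, mem_Ioo, mem_ofPred_eq, ht.1, ht.2, zero_add, true_and,
      add_comm t L]
    split_ifs <;> simp
  have e2 : ∀ᵐ ξ, (∫ t in Ioo 0 τ, f ξ * m (t, ξ))
      = (Ioo 0 L).indicator (fun ξ => f ξ * conj (φ (0, ξ))) ξ
        + (Ioo L (L + τ)).indicator (fun ξ => f ξ * conj (φ (ξ - L, L))) ξ
        - (Ioo τ (L + τ)).indicator (fun ξ => f ξ * conj (φ (τ, ξ - τ))) ξ := by
    filter_upwards [Measure.ae_ne volume (0 : ℝ), Measure.ae_ne volume L, Measure.ae_ne volume τ,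
      Measure.ae_ne volume (L + τ)] with ξ h0 h1 h2 h3
    have := setIntegral_transportSymbol_characteristic hL hτ hφ hφ0 h0 h1 h2 h3
    rw [integral_const_mul, indicator_mul_right, indicator_mul_right, indicator_mul_right,
      ← mul_add, ← mul_sub, ← this, ← setIntegral_indicator measurableSet_Ioo]
    congr 1
    refine setIntegral_congr_fun measurableSet_Ioo fun t ht => ?_
    simp only [hm, indicator, hS, mem_Ioo, mem_ofPred_eq, ht.1, ht.2, true_and]
    congr 1
    rw [sub_lt_iff_lt_add, and_comm, eq_iff_iff]
  have bdd : ∀ {k : ℝ → ℂ} {a b : ℝ}, Continuous k →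
      Integrable ((Ioo a b).indicator fun ξ => f ξ * k ξ) := by
    intro k a b hk
    rw [integrable_indicator_iff measurableSet_Ioo]
    obtain ⟨C, hC⟩ := (isCompact_Icc (a := a) (b := b)).exists_bound_of_continuousOn
      hk.continuousOn
    refine hf.restrict.mul_bdd (c := C) hk.aestronglyMeasurable ?_
    filter_upwards [ae_restrict_mem measurableSet_Ioo] with x hx
    exact hC x (Ioo_subset_Icc_self hx)
  have c1 : Continuous fun ξ => conj (φ (0, ξ)) :=
    Complex.continuous_conj.comp (hφ.continuous.comp (by fun_prop))
  have c2 : Continuous fun ξ => conj (φ (ξ - L, L)) :=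
    Complex.continuous_conj.comp (hφ.continuous.comp (by fun_prop))
  have c3 : Continuous fun ξ => conj (φ (τ, ξ - τ)) :=
    Complex.continuous_conj.comp (hφ.continuous.comp (by fun_prop))
  have s1 := setIntegral_Ioo_comp_add (F := fun ξ => f ξ * conj (φ (ξ - L, L))) 0 τ L
  have s2 := setIntegral_Ioo_comp_add (F := fun ξ => f ξ * conj (φ (τ, ξ - τ))) 0 L τ
  simp only [add_sub_cancel_right, zero_add, add_comm τ L] at s1 s2
  rw [setIntegral_congr_fun measurableSet_Ioo e1, hswap, integral_congr_ae e2,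
    integral_sub ((bdd c1).fun_add (bdd c2)) (bdd c3), integral_add (bdd c1) (bdd c2),
    integral_indicator measurableSet_Ioo, integral_indicator measurableSet_Ioo,
    integral_indicator measurableSet_Ioo, s1, s2]

/-- `integral_transport` with initial time `s`. -/
theorem integral_transport_from {L s τ : ℝ} (hL : 0 < L) (hs : 0 ≤ s) (hsτ : s ≤ τ) {f : ℝ → ℂ}
    (hf : Integrable f) {φ : ℝ × ℝ → ℂ} (hφ : ContDiff ℝ 1 φ)
    (hφ0 : ∀ t ∈ Icc 0 τ, φ (t, 0) = 0) (hfL : ∀ x, L < x → f x = 0) :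
    ∫ t in Ioo s τ, ∫ x in Ioo 0 L, f (x + (t - s)) * transportSymbol φ t x
      = (∫ x in Ioo 0 L, f x * conj (φ (s, x)))
        - ∫ x in Ioo 0 L, f (x + (τ - s)) * conj (φ (τ, x)) := by
  set φs : ℝ × ℝ → ℂ := fun p => φ (p.1 + s, p.2) with hφs
  have hφsc : ContDiff ℝ 1 φs := hφ.comp
    ((contDiff_fst.add contDiff_const).prodMk contDiff_snd)
  have h := integral_transport hL (sub_nonneg.2 hsτ) hf hφsc
    (fun t ht => hφ0 _ ⟨add_nonneg ht.1 hs, by linarith [ht.2]⟩)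
  have e0 : ∀ t x, transportSymbol φs t x = transportSymbol φ (t + s) x := by
    intro t x
    simp only [transportSymbol, hφs]
    rw [deriv_comp_add_const (fun r => φ (r, x))]
  have e1 := setIntegral_Ioo_comp_add (F := fun t =>
    ∫ x in Ioo 0 L, f (x + (t - s)) * transportSymbol φ t x) 0 (τ - s) s
  simp only [zero_add, sub_add_cancel, add_sub_cancel_right] at e1
  -- Nothing enters through `x = L`, since `f` vanishes beyond `L`.
  have e2 : ∫ t in Ioo 0 (τ - s), f (t + L) * conj (φs (t, L)) = 0 := by
    rw [setIntegral_congr_fun (g := fun _ => 0) measurableSet_Ioo, integral_zero]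
    intro t ht
    simp [hfL (t + L) (by linarith [ht.1])]
  rw [e2] at h
  simp only [e0, e1] at h
  simp only [hφs, zero_add, sub_add_cancel, add_zero] at h
  exact h

/-! ### Convolution equations on the circle -/

section Circle

open AddCircle

variable {T : ℝ} [hT : Fact (0 < T)]

theorem summable_sq_fourierCoeff {f : AddCircle T → ℂ} (hf : MemLp f 2 haarAddCircle) :
    Summable fun n => ‖fourierCoeff f n‖ ^ 2 := by
  have := (hasSum_sq_fourierCoeff hf.toLp).summable
  rwa [fourierCoeff_congr_ae hf.coeFn_toLp] at this

theorem ae_eq_const_of_fourierCoeff_eq_zero {f : AddCircle T → ℂ} (hf : MemLp f 2 haarAddCircle)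
    (h : ∀ n : ℤ, n ≠ 0 → fourierCoeff f n = 0) :
    ∃ c : ℂ, f =ᵐ[haarAddCircle] fun _ => c := by
  refine ⟨fourierCoeff f 0, ?_⟩
  have h1 := hasSum_fourier_series_L2 hf.toLp
  rw [fourierCoeff_congr_ae hf.coeFn_toLp] at h1
  have h2 := hasSum_single (f := fun i => fourierCoeff f i • fourierLp (T := T) 2 i) (0 : ℤ)
    (fun n hn => by rw [h n hn, zero_smul])
  have h3 := h1.unique h2
  filter_upwards [hf.coeFn_toLp, Lp.coeFn_smul (fourierCoeff f 0) (fourierLp (T := T) 2 0),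
    coeFn_fourierLp (T := T) 2 0] with t a1 a2 a3
  rw [← a1, h3, a2, Pi.smul_apply, a3, fourier_zero, smul_eq_mul, mul_one]

theorem fourier_add_apply {T : ℝ} (n : ℤ) (x y : AddCircle T) :
    fourier n (x + y) = fourier n x * fourier n y := by
  simp [fourier_apply, smul_add, AddCircle.toCircle_add]

/-- Riesz–Fischer. -/
theorem exists_fourierCoeff_eq {b : ℤ → ℂ} (hb : Summable fun n => ‖b n‖ ^ 2) :
    ∃ J : Lp ℂ 2 (@haarAddCircle T hT), ∀ n, fourierCoeff J n = b n := by
  have hmem : Memℓp b 2 := memℓp_gen (by simpa using hb)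
  refine ⟨fourierBasis.repr.symm ⟨b, hmem⟩, fun n => ?_⟩
  rw [← fourierBasis_repr, LinearIsometryEquiv.apply_symm_apply]

section Convolution

variable {J P : AddCircle T → ℂ} {C : ℝ}

theorem integrable_convolution_integrand (hJ : Integrable J haarAddCircle) (hP : Measurable P)
    (hC : ∀ x, ‖P x‖ ≤ C) :
    Integrable (fun p : AddCircle T × AddCircle T => J p.2 * P (p.1 - p.2))
      (haarAddCircle.prod haarAddCircle) :=
  (hJ.comp_snd haarAddCircle).mul_bdd (c := C)
    (hP.comp (measurable_fst.sub measurable_snd)).aestronglyMeasurable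
    (Filter.Eventually.of_forall fun _ => hC _)

theorem memLp_convolution (hJ : Integrable J haarAddCircle) (hP : Measurable P)
    (hC : ∀ x, ‖P x‖ ≤ C) :
    MemLp (fun t => ∫ s, J s * P (t - s) ∂haarAddCircle) 2 haarAddCircle := by
  refine MemLp.of_bound (integrable_convolution_integrand hJ hP hC).1.integral_prod_right'
    ((∫ s, ‖J s‖ ∂haarAddCircle) * C) (Filter.Eventually.of_forall fun t => ?_)
  refine (norm_integral_le_integral_norm _).trans ?_
  rw [← integral_mul_const]
  refine integral_mono_of_nonneg (Filter.Eventually.of_forall fun _ => norm_nonneg _)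
    (hJ.norm.mul_const C) (Filter.Eventually.of_forall fun s => ?_)
  simp only [norm_mul]
  exact mul_le_mul_of_nonneg_left (hC _) (norm_nonneg _)

/-- Fubini, then translation invariance and multiplicativity of the characters. -/
theorem fourierCoeff_convolution (hJ : Integrable J haarAddCircle) (hP : Measurable P)
    (hC : ∀ x, ‖P x‖ ≤ C) (n : ℤ) :
    fourierCoeff (fun t => ∫ s, J s * P (t - s) ∂haarAddCircle) n
      = fourierCoeff J n * fourierCoeff P n := by
  have hint : Integrable (fun p : AddCircle T × AddCircle T =>
      fourier (-n) p.1 * (J p.2 * P (p.1 - p.2))) (haarAddCircle.prod haarAddCircle) := by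
    refine (integrable_convolution_integrand hJ hP hC).bdd_mul (c := 1)
      ((map_continuous (fourier (-n))).comp continuous_fst).aestronglyMeasurable
      (Filter.Eventually.of_forall fun p => ?_)
    rw [fourier_apply, Circle.norm_coe]
  have hl : ∀ t, fourier (-n) t • ∫ s, J s * P (t - s) ∂haarAddCircle
      = ∫ s, fourier (-n) t * (J s * P (t - s)) ∂haarAddCircle := fun t => by
    rw [smul_eq_mul, integral_const_mul]
  simp only [fourierCoeff, hl]
  simp only [smul_eq_mul]
  rw [integral_integral_swap (f := fun t s => fourier (-n) t * (J s * P (t - s))) hint,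
    ← integral_mul_const]
  congr 1; ext s
  rw [← integral_add_right_eq_self _ s, ← integral_const_mul]
  congr 1; ext t
  rw [fourier_add_apply, add_sub_cancel_right]; ring

end Convolution

/-- If `1 - T P̂(n)` vanishes for no `n ≠ 0`, then `J - J * P = h` has a solution modulo
constants. -/
theorem exists_convolution_solution {P h : AddCircle T → ℂ} {C : ℝ} (hP : Measurable P)
    (hC : ∀ x, ‖P x‖ ≤ C) (hh : MemLp h 2 haarAddCircle)
    (hne : ∀ n : ℤ, n ≠ 0 → T * fourierCoeff P n ≠ 1) :
    ∃ (J : Lp ℂ 2 (@haarAddCircle T hT)) (c : ℂ), ∀ᵐ t ∂haarAddCircle,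
      J t = T * (∫ s, J s * P (t - s) ∂haarAddCircle) + h t + c := by
  have hPL : MemLp P 2 haarAddCircle :=
    MemLp.of_bound hP.aestronglyMeasurable C (Filter.Eventually.of_forall hC)
  have hlim : Filter.Tendsto (fun n => fourierCoeff P n) Filter.cofinite (nhds 0) := by
    have h1 := (summable_sq_fourierCoeff hPL).tendsto_cofinite_zero
    rw [tendsto_zero_iff_norm_tendsto_zero]
    have h2 := h1.sqrt
    simpa using h2
  -- The coefficients of `P` tend to `0`, so the inverses converge and are bounded. If the factor at
  -- `n = 0` vanishes, its inverse is `0` by convention; this is harmless, as that mode is never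
  -- solved for.
  have hinv : Filter.Tendsto (fun n => ‖(1 - T * fourierCoeff P n)⁻¹‖) Filter.cofinite
      (nhds 1) := by
    have h1 : Filter.Tendsto (fun n => 1 - T * fourierCoeff P n) Filter.cofinite
        (nhds (1 - T * 0)) := (hlim.const_mul (T : ℂ)).const_sub 1
    have h2 := (h1.inv₀ (by simp)).norm
    simpa using h2
  obtain ⟨B, hB⟩ := hinv.bddAbove_range_of_cofinite
  have hB' : ∀ n, ‖(1 - T * fourierCoeff P n)⁻¹‖ ≤ B := fun n => hB ⟨n, rfl⟩
  have hb : Summable fun n => ‖(1 - T * fourierCoeff P n)⁻¹ * fourierCoeff h n‖ ^ 2 := by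
    refine Summable.of_nonneg_of_le (fun _ => by positivity) (fun n => ?_)
      ((summable_sq_fourierCoeff hh).mul_left (B ^ 2))
    rw [norm_mul, mul_pow]
    gcongr
    exact hB' n
  obtain ⟨J, hJ⟩ := exists_fourierCoeff_eq (T := T) hb
  have hJi : Integrable J haarAddCircle := (Lp.memLp J).integrable (by norm_num)
  have hK := memLp_convolution hJi hP hC
  have hr := ((Lp.memLp J).sub (hK.const_mul (T : ℂ))).sub hh
  -- The residual `J - T J * P - h` has no nonzero mode, so it is a constant `c`.
  obtain ⟨c, hc⟩ := ae_eq_const_of_fourierCoeff_eq_zero hr (by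
    intro n hn
    have i1 : Integrable (fun t => T * ∫ s, J s * P (t - s) ∂haarAddCircle) haarAddCircle :=
      (hK.const_mul (T : ℂ)).integrable (by norm_num)
    have i2 : Integrable h haarAddCircle := hh.integrable (by norm_num)
    have e1 := fourierCoeff.const_mul (fun t => ∫ s, J s * P (t - s) ∂haarAddCircle) (T : ℂ) n
    rw [fourierCoeff_convolution hJi hP hC, hJ] at e1
    have e2 : fourierCoeff (((J : AddCircle T → ℂ) - fun t => T * ∫ s, J s * P (t - s) ∂haarAddCircle) - h) n
        = fourierCoeff J n
          - fourierCoeff (fun t => T * ∫ s, J s * P (t - s) ∂haarAddCircle) n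
          - fourierCoeff h n := by
      simp only [fourierCoeff, Pi.sub_apply, smul_sub]
      have i3 : Integrable (fun t => fourier (-n) t • J t
          - fourier (-n) t • (T * ∫ s, J s * P (t - s) ∂haarAddCircle)) haarAddCircle :=
        (hJi.fourier_smul _).sub (i1.fourier_smul _)
      rw [integral_sub i3 (i2.fourier_smul _),
        integral_sub (hJi.fourier_smul _) (i1.fourier_smul _)]
    refine e2.trans ?_
    rw [e1, hJ]
    have h0 : 1 - T * fourierCoeff P n ≠ 0 := sub_ne_zero.2 (hne n hn).symm
    field_simp
    ring)
  refine ⟨J, c, ?_⟩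
  filter_upwards [hc] with t ht
  simp only [Pi.sub_apply] at ht
  linear_combination ht

end Circle

/-! ### The integral equation for the mean value of the solution -/

section IntegralEquation

variable {L : ℝ}

/-- Extension by zero of a function on `(0, L)`. -/
def zeroExt (g : L2 L) : ℝ → ℂ := (Ioo 0 L).indicator g

theorem stronglyMeasurable_zeroExt (g : L2 L) : StronglyMeasurable (zeroExt g) :=
  (Lp.stronglyMeasurable g).indicator measurableSet_Ioo

theorem integrable_zeroExt (g : L2 L) : Integrable (zeroExt g) :=
  (integrable_indicator_iff measurableSet_Ioo).2 g.integrable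

theorem zeroExt_of_mem (g : L2 L) {x : ℝ} (hx : x ∈ Ioo 0 L) : zeroExt g x = g x :=
  indicator_of_mem hx _

theorem zeroExt_of_notMem (g : L2 L) {x : ℝ} (hx : x ∉ Ioo 0 L) : zeroExt g x = 0 :=
  indicator_of_notMem hx _

/-- The tail integral `r ↦ ∫ᵣ^∞ g`, for `g` extended by zero. -/
def tailIntegral (g : L2 L) (r : ℝ) : ℂ := ∫ x in Ioi r, zeroExt g x

theorem tailIntegral_of_le (g : L2 L) {r : ℝ} (hr : L ≤ r) : tailIntegral g r = 0 := by
  rw [tailIntegral, setIntegral_congr_fun (g := fun _ => 0) measurableSet_Ioi, integral_zero]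
  intro x hx
  exact zeroExt_of_notMem g fun h => absurd (h.2.trans_le hr) (not_lt.2 (le_of_lt hx))

theorem norm_tailIntegral_le (g : L2 L) (r : ℝ) :
    ‖tailIntegral g r‖ ≤ ∫ x, ‖zeroExt g x‖ :=
  (norm_integral_le_integral_norm _).trans (setIntegral_le_integral (integrable_zeroExt g).norm
    (Filter.Eventually.of_forall fun _ => norm_nonneg _))

theorem setIntegral_Ioo_zeroExt (g : L2 L) {a b : ℝ} (hab : a ≤ b) :
    ∫ x in Ioo a b, zeroExt g x = tailIntegral g a - tailIntegral g b := by
  rw [tailIntegral, tailIntegral, ← Ioc_union_Ioi_eq_Ioi hab,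
    setIntegral_union (Ioc_disjoint_Ioi le_rfl) measurableSet_Ioi
      (integrable_zeroExt g).integrableOn (integrable_zeroExt g).integrableOn,
    integral_Ioc_eq_integral_Ioo, add_sub_cancel_right]

theorem continuous_tailIntegral (g : L2 L) : Continuous (tailIntegral g) := by
  have h : tailIntegral g = fun r => tailIntegral g 0 - ∫ x in (0 : ℝ)..r, zeroExt g x := by
    ext r
    rcases le_total 0 r with h | h
    · rw [intervalIntegral.integral_of_le h, integral_Ioc_eq_integral_Ioo,
        setIntegral_Ioo_zeroExt g h]; ring
    · rw [intervalIntegral.integral_of_ge h, integral_Ioc_eq_integral_Ioo,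
        setIntegral_Ioo_zeroExt g h]; ring
  rw [h]
  exact continuous_const.sub
    (intervalIntegral.continuous_primitive (fun _ _ => (integrable_zeroExt g).intervalIntegrable) 0)

/-- Integration by parts: the tail has derivative `-g`, and `E_l` is a primitive of the exponential.
Writing the tail as its value at `0` minus a primitive of `g`, the constant part is killed by
`E_l(L) = 0`. -/
theorem integral_exp_mul_tailIntegral (hL : 0 < L) (g : L2 L) {l : ℂ}
    (hl : expPrimitive l L = 0) :
    ∫ x in Ioo 0 L, Complex.exp (-l * x) * tailIntegral g x
      = ∫ x in Ioo 0 L, g x * expPrimitive l x := by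
  have e1 := integral_deriv_mul_primitive (hasDerivAt_expPrimitive l) (continuous_exp_mul l) hl
    g.integrable
  have e2 : ∀ x ∈ Ioo 0 L, Complex.exp (-l * x) * tailIntegral g x
      = tailIntegral g 0 * Complex.exp (-l * x)
        - Complex.exp (-l * x) * ∫ y in Ioo 0 x, g y := by
    intro x hx
    have := setIntegral_Ioo_zeroExt g hx.1.le
    rw [setIntegral_congr_fun (g := g) measurableSet_Ioo fun y hy =>
      zeroExt_of_mem g ⟨hy.1, hy.2.trans hx.2⟩] at this
    rw [this]; ring
  have e3 : ∫ x in Ioo 0 L, Complex.exp (-l * x) = 0 := by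
    rw [setIntegral_Ioo_eq hL.le]; exact hl
  rw [setIntegral_congr_fun measurableSet_Ioo e2, integral_sub, integral_const_mul, e3, e1]
  · simp [mul_comm]
  · exact (integrable_of_continuous L (continuous_exp_mul l)).const_mul _
  · simpa [mul_comm] using
      integrable_mul_continuous (integrable_primitive g.integrable) (continuous_exp_mul l)

variable [hT : Fact (0 < L)]

/-- The `L`-periodic function that agrees with `tailIntegral g` on `(0, L]`. -/
def periodicTail (g : L2 L) : AddCircle L → ℂ := AddCircle.liftIoc L 0 (tailIntegral g)

theorem measurable_periodicTail (g : L2 L) : Measurable (periodicTail g) :=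
  ((continuous_tailIntegral g).measurable.comp measurable_subtype_coe).comp
    (AddCircle.measurableEquivIoc L 0).measurable

theorem norm_periodicTail_le (g : L2 L) (x : AddCircle L) :
    ‖periodicTail g x‖ ≤ ∫ x, ‖zeroExt g x‖ :=
  norm_tailIntegral_le g _

theorem periodicTail_coe (g : L2 L) {x : ℝ} (hx : x ∈ Ioc 0 L) :
    periodicTail g x = tailIntegral g x :=
  AddCircle.liftIoc_coe_apply (by rwa [zero_add])

/-- Identifies the two kernels of the integral equation as one periodic convolution kernel. For `s <
t` the second term vanishes because `L + t - s > L`; for `s ≥ t` the argument is moved into `(0, L]`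
by one period. -/
theorem periodicTail_coe_sub (g : L2 L) {s t : ℝ} (hs : s ∈ Ioo 0 L) (ht : t ∈ Ioo 0 L) :
    periodicTail g ((t : AddCircle L) - (s : AddCircle L))
      = (Iio t).indicator (fun s => tailIntegral g (t - s)) s + tailIntegral g (L + t - s) := by
  rw [← AddCircle.coe_sub]
  by_cases hst : s < t
  · rw [indicator_of_mem (by exact hst), tailIntegral_of_le g (r := L + t - s) (by linarith),
      add_zero, periodicTail_coe g ⟨by linarith, by linarith [hs.1, ht.2]⟩]
  · rw [indicator_of_notMem (by exact hst), zero_add, ← AddCircle.coe_add_period L (t - s),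
      periodicTail_coe g ⟨by linarith [hs.2, ht.1], by linarith⟩]
    congr 1; ring

/-- With `l = 2πin/L`, which satisfies `E_l(L) = 0`, the coefficient is `∫ g E_l`; nonresonance is
applied at `conj l`. -/
theorem mul_fourierCoeff_periodicTail_ne_one {g : L2 L} (hg : Nonresonant L g) {n : ℤ}
    (hn : n ≠ 0) : L * fourierCoeff (periodicTail g) n ≠ 1 := by
  have hL : 0 < L := hT.out
  have hL' : (L : ℂ) ≠ 0 := by exact_mod_cast hL.ne'
  set l : ℂ := 2 * Real.pi * Complex.I * n / L with hl
  have hlL : l * L = n * (2 * Real.pi * Complex.I) := by rw [hl]; field_simp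
  have hl0 : l ≠ 0 := by
    rw [hl]
    have : (n : ℂ) ≠ 0 := by exact_mod_cast hn
    have := Complex.two_pi_I_ne_zero
    positivity
  have hEL : expPrimitive l L = 0 := by
    have := mul_expPrimitive l L
    rw [neg_mul, hlL, Complex.exp_neg, Complex.exp_int_mul_two_pi_mul_I, inv_one, sub_self] at this
    exact (mul_eq_zero.1 this).resolve_left hl0
  have hcoef : L * fourierCoeff (periodicTail g) n
      = ∫ x in Ioo 0 L, Complex.exp (-l * x) * tailIntegral g x := by
    rw [fourierCoeff_eq_intervalIntegral _ n 0, zero_add, setIntegral_Ioo_eq hL.le,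
      Complex.real_smul, ← mul_assoc]
    push_cast
    rw [mul_one_div_cancel hL', one_mul]
    refine intervalIntegral.integral_congr_ae (Filter.Eventually.of_forall fun x hx => ?_)
    rw [uIoc_of_le hL.le] at hx
    rw [periodicTail_coe g hx, fourier_coe_apply, smul_eq_mul]
    congr 2
    rw [hl]; push_cast; field_simp
  rw [hcoef, integral_exp_mul_tailIntegral hL g hEL]
  have := hg (conj l) (by rw [← conj_expPrimitive, hEL, map_zero])
  simpa only [conj_expPrimitive, Complex.conj_conj] using this

/-- `haarAddCircle` has total mass `1`, whence the factor `L`. -/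
theorem setIntegral_Ioo_coe_addCircle (f : AddCircle L → ℂ) :
    ∫ s in Ioo 0 L, f s = L * ∫ s, f s ∂AddCircle.haarAddCircle := by
  have h := AddCircle.integral_preimage L 0 f
  rw [zero_add, integral_Ioc_eq_integral_Ioo] at h
  have hL' : (L : ℂ) ≠ 0 := by exact_mod_cast hT.out.ne'
  rw [AddCircle.integral_haarAddCircle, h, Complex.real_smul, ← mul_assoc]
  push_cast
  rw [mul_inv_cancel₀ hL', one_mul]

theorem measurePreserving_coe_addCircle :
    MeasurePreserving ((↑) : ℝ → AddCircle L) (intervalMeasure L) volume := by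
  have := AddCircle.measurePreserving_mk L 0
  rwa [zero_add, ← Measure.restrict_congr_set Ioo_ae_eq_Ioc] at this

/-- Solvability of the integral equation satisfied by the mean value `∫₀ᴸ u(t, x) dx` of a
solution that is steered to a given target at time `L`. -/
theorem exists_integral_equation_solution {g : L2 L} (hg : Nonresonant L g) {h : ℝ → ℂ}
    (hh : MemLp h 2 (intervalMeasure L)) :
    ∃ I : ℝ → ℂ, Integrable I (intervalMeasure L) ∧ ∀ᵐ t ∂(intervalMeasure L),
      I t = h t + (∫ s in Ioo 0 t, I s * tailIntegral g (t - s))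
        + (∫ s in Ioo 0 L, I s * tailIntegral g (L + t - s))
        - ∫ s in Ioo 0 L, I s * tailIntegral g (L - s) := by
  have hL : 0 < L := hT.out
  have hh' : MemLp (AddCircle.liftIoc L 0 h) 2 AddCircle.haarAddCircle := by
    refine MemLp.haarAddCircle (MemLp.memLp_liftIoc ?_)
    rwa [zero_add, ← Measure.restrict_congr_set Ioo_ae_eq_Ioc]
  obtain ⟨J, c, hJ⟩ := exists_convolution_solution (measurable_periodicTail g)
    (norm_periodicTail_le g) hh' fun n hn => mul_fourierCoeff_periodicTail_ne_one hg hn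
  have hJi : Integrable J AddCircle.haarAddCircle := (Lp.memLp J).integrable (by norm_num)
  have hJv : Integrable J := by
    rw [AddCircle.volume_eq_smul_haarAddCircle]
    exact hJi.smul_measure ENNReal.ofReal_ne_top
  have hJ' : ∀ᵐ t ∂(volume : Measure (AddCircle L)),
      J t = L * (∫ s, J s * periodicTail g (t - s) ∂AddCircle.haarAddCircle)
        + AddCircle.liftIoc L 0 h t + c := by
    rw [AddCircle.volume_eq_smul_haarAddCircle]
    exact Measure.ae_smul_measure hJ _
  have hJc : Integrable (fun s : ℝ => J s) (intervalMeasure L) :=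
    measurePreserving_coe_addCircle.integrable_comp_of_integrable hJv
  have hΓ : Continuous fun s => tailIntegral g (L - s) :=
    (continuous_tailIntegral g).comp (continuous_const.sub continuous_id)
  set d := ∫ s in Ioo 0 L, J s * tailIntegral g (L - s) with hd
  -- Adding a constant `κ` to `J` changes the convolution and the functional `∫ I Γ(L - s)` by the
  -- same amount `κ ∫ Γ`, which cancels in the equation. What is left is `c + κ = -d`, whether or
  -- not the mode `n = 0` is resonant.
  set I : ℝ → ℂ := fun s => J s + (-d - c) with hI
  have hIi : Integrable I (intervalMeasure L) := hJc.add (integrable_const _)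
  refine ⟨I, hIi, ?_⟩
  filter_upwards [measurePreserving_coe_addCircle.quasiMeasurePreserving.ae hJ',
    ae_restrict_mem measurableSet_Ioo] with t h1 ht
  have hPi : Integrable (fun s : ℝ => periodicTail g ((t : AddCircle L) - (s : AddCircle L)))
      (intervalMeasure L) := by
    refine Integrable.of_bound ((measurable_periodicTail g).comp
      (AddCircle.measurable_mk'.const_sub _)).aestronglyMeasurable _
      (Filter.Eventually.of_forall fun s => norm_periodicTail_le g _)
  have hJP : Integrable (fun s : ℝ => J s * periodicTail g ((t : AddCircle L) - (s : AddCircle L)))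
      (intervalMeasure L) :=
    hJc.mul_bdd hPi.1 (Filter.Eventually.of_forall fun s => norm_periodicTail_le g _)
  have c1 : ∫ s in Ioo 0 L, periodicTail g ((t : AddCircle L) - (s : AddCircle L))
      = ∫ s in Ioo 0 L, tailIntegral g (L - s) := by
    have a1 := setIntegral_Ioo_coe_addCircle
      (fun s => periodicTail g ((t : AddCircle L) - s))
    have a2 := setIntegral_Ioo_coe_addCircle (periodicTail g)
    rw [integral_sub_left_eq_self (periodicTail g) _ (t : AddCircle L), ← a2] at a1
    rw [a1, setIntegral_congr_fun measurableSet_Ioo fun s hs =>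
      periodicTail_coe g ⟨hs.1, hs.2.le⟩, setIntegral_Ioo_eq hL.le, setIntegral_Ioo_eq hL.le,
      intervalIntegral.integral_comp_sub_left (tailIntegral g)]
    simp
  have c2 : ∫ s in Ioo 0 L, I s * periodicTail g ((t : AddCircle L) - (s : AddCircle L))
      = (∫ s in Ioo 0 t, I s * tailIntegral g (t - s))
        + ∫ s in Ioo 0 L, I s * tailIntegral g (L + t - s) := by
    have a1 : ∫ s in Ioo 0 t, I s * tailIntegral g (t - s)
        = ∫ s in Ioo 0 L, (Iio t).indicator (fun s => I s * tailIntegral g (t - s)) s := by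
      rw [setIntegral_indicator measurableSet_Iio]
      congr 2
      ext s; simp only [mem_Ioo, mem_inter_iff, mem_Iio]
      constructor
      · rintro ⟨a, b⟩; exact ⟨⟨a, b.trans ht.2⟩, b⟩
      · rintro ⟨a, b⟩; exact ⟨a.1, b⟩
    rw [a1, ← integral_add]
    · refine setIntegral_congr_fun measurableSet_Ioo fun s hs => ?_
      simp only [periodicTail_coe_sub g hs ht, indicator_mul_right, mul_add]
    · refine Integrable.indicator ?_ measurableSet_Iio
      exact integrable_mul_continuous hIi
        ((continuous_tailIntegral g).comp (continuous_const.sub continuous_id))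
    · exact integrable_mul_continuous hIi
        ((continuous_tailIntegral g).comp (continuous_const.sub continuous_id))
  have c3 : ∫ s in Ioo 0 L, I s * periodicTail g ((t : AddCircle L) - (s : AddCircle L))
      = (∫ s in Ioo 0 L, J s * periodicTail g ((t : AddCircle L) - (s : AddCircle L)))
        + (-d - c) * ∫ s in Ioo 0 L, tailIntegral g (L - s) := by
    rw [← c1, ← integral_const_mul, ← integral_add hJP (hPi.const_mul _)]
    simp only [hI, add_mul]
  have c4 : ∫ s in Ioo 0 L, I s * tailIntegral g (L - s)
      = d + (-d - c) * ∫ s in Ioo 0 L, tailIntegral g (L - s) := by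
    rw [hd, ← integral_const_mul, ← integral_add (integrable_mul_continuous hJc hΓ)
      ((integrable_of_continuous L hΓ).const_mul _), ← hd]
    simp only [hI, add_mul]
  have c5 := setIntegral_Ioo_coe_addCircle
    (fun s => J s * periodicTail g ((t : AddCircle L) - s))
  rw [← c5, AddCircle.liftIoc_coe_apply (by rw [zero_add]; exact ⟨ht.1, ht.2.le⟩)] at h1
  have h2 : I t = J t + (-d - c) := rfl
  linear_combination h2 + h1 - c3 + c2 + c4

end IntegralEquation

/-! ### Translations of `L²(ℝ)` and the variation of constants formula -/

/-- The Hilbert space `L²(ℝ)`. -/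
abbrev LineL2 : Type := Lp ℂ 2 (volume : Measure ℝ)

/-- The left translation `f ↦ f(· + t)` of `L²(ℝ)`. -/
def translate (t : ℝ) : LineL2 →L[ℂ] LineL2 :=
  (Lp.compMeasurePreservingₗᵢ ℂ (fun x : ℝ => x + t)
    (measurePreserving_add_right volume t)).toContinuousLinearMap

theorem coeFn_translate (t : ℝ) (f : LineL2) : translate t f =ᵐ[volume] fun x => f (x + t) :=
  Lp.coeFn_compMeasurePreserving f (measurePreserving_add_right volume t)

theorem norm_translate (t : ℝ) (f : LineL2) : ‖translate t f‖ = ‖f‖ :=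
  Lp.norm_compMeasurePreserving f (measurePreserving_add_right volume t)

theorem translate_translate (t s : ℝ) (f : LineL2) :
    translate t (translate s f) = translate (t + s) f := by
  apply Lp.ext
  have h := (measurePreserving_add_right volume t).quasiMeasurePreserving.ae (coeFn_translate s f)
  filter_upwards [coeFn_translate t (translate s f), coeFn_translate (t + s) f, h] with x h1 h2 h3
  rw [h1, h2, h3, add_assoc]

theorem continuous_translate {f : ℝ → LineL2} (hf : Continuous f) :
    Continuous fun t => translate t (f t) :=
  hf.compMeasurePreservingLp
    (g := fun t => (⟨fun x => x + t, by fun_prop⟩ : C(ℝ, ℝ)))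
    (ContinuousMap.curry ⟨fun p : ℝ × ℝ => p.2 + p.1, by fun_prop⟩).continuous
    (fun t => measurePreserving_add_right volume t) (by norm_num)

variable {L : ℝ}

/-- The restriction to `(0, L)`. -/
def restrictL (L : ℝ) : LineL2 →L[ℂ] L2 L := LpToLpRestrictCLM ℝ ℂ ℂ volume 2 (Ioo 0 L)

theorem coeFn_restrictL_translate (L t : ℝ) (f : LineL2) :
    restrictL L (translate t f) =ᵐ[intervalMeasure L] fun x => f (x + t) :=
  (LpToLpRestrictCLM_coeFn ℂ (Ioo 0 L) (translate t f)).trans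
    (ae_restrict_of_ae (coeFn_translate t f))

/-- Extension by zero, as an element of `L²(ℝ)`. -/
def zeroExtLp (g : L2 L) : LineL2 :=
  ((memLp_indicator_iff_restrict measurableSet_Ioo).2 (Lp.memLp g)).toLp

theorem coeFn_zeroExtLp (g : L2 L) : zeroExtLp g =ᵐ[volume] zeroExt g :=
  MemLp.coeFn_toLp _

/-- The functional `v ↦ ∫₀ᴸ v ζ`. -/
def pairing {ζ : ℝ → ℂ} (hζ : MemLp ζ 2 (intervalMeasure L)) : L2 L →L[ℂ] ℂ :=
  innerSL ℂ hζ.star.toLp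

theorem pairing_apply {ζ : ℝ → ℂ} (hζ : MemLp ζ 2 (intervalMeasure L)) (v : L2 L) :
    pairing hζ v = ∫ x in Ioo 0 L, v x * ζ x := by
  rw [pairing, innerSL_apply_apply, inner_eq_integral]
  apply integral_congr_ae
  filter_upwards [hζ.star.coeFn_toLp] with x hx
  rw [hx]; simp

/-- The Duhamel term `∫₀ᵗ I(s) g(· - s) ds`, translated back to time `0`. -/
def duhamel (g : L2 L) (I : ℝ → ℂ) (t : ℝ) : LineL2 :=
  ∫ s in (0 : ℝ)..t, I s • translate (-s) (zeroExtLp g)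

section Duhamel

variable (g : L2 L) {I : ℝ → ℂ} (hI : Integrable I)

include hI

theorem integrable_duhamel : Integrable fun s => I s • translate (-s) (zeroExtLp g) := by
  have hc : Continuous fun s : ℝ => translate (-s) (zeroExtLp g) :=
    (continuous_translate (f := fun _ => zeroExtLp g) continuous_const).comp continuous_neg
  refine (hI.norm.mul_const ‖zeroExtLp g‖).mono' (hI.1.smul hc.aestronglyMeasurable)
    (Filter.Eventually.of_forall fun s => ?_)
  rw [norm_smul, norm_translate]

theorem continuous_duhamel : Continuous (duhamel g I) :=
  intervalIntegral.continuous_primitive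
    (fun _ _ => (integrable_duhamel g hI).intervalIntegrable) 0

/-- A continuous linear functional passes through the Bochner integral. Allowing any `ζ` in `L²`
covers both smooth weights and indicators of subintervals. -/
theorem integral_translate_duhamel {ζ : ℝ → ℂ} (hζ : MemLp ζ 2 (intervalMeasure L)) (t r : ℝ) :
    ∫ x in Ioo 0 L, restrictL L (translate t (duhamel g I r)) x * ζ x
      = ∫ s in (0 : ℝ)..r, I s * ∫ x in Ioo 0 L, zeroExt g (x + (t - s)) * ζ x := by
  rw [← pairing_apply hζ]
  have h := (((pairing hζ).comp (restrictL L)).comp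
    (translate t)).intervalIntegral_comp_comm
    ((integrable_duhamel g hI).intervalIntegrable (a := 0) (b := r))
  refine h.symm.trans (intervalIntegral.integral_congr fun s _ => ?_)
  simp only [map_smul, ContinuousLinearMap.comp_apply, smul_eq_mul]
  rw [translate_translate, pairing_apply]
  congr 1
  apply integral_congr_ae
  have h2 := (measurePreserving_add_right volume (t + -s)).quasiMeasurePreserving.ae
    (coeFn_zeroExtLp g)
  filter_upwards [coeFn_restrictL_translate L (t + -s) (zeroExtLp g),
    ae_restrict_of_ae h2] with x h3 h4
  rw [h3, h4, sub_eq_add_neg]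

end Duhamel

/-- The solution with free part `w` and mean value `I`. -/
def mildSolution (g : L2 L) (w : LineL2) (I : ℝ → ℂ) (t : ℝ) : L2 L :=
  restrictL L (translate t (w + duhamel g I t))

theorem continuous_mildSolution (g : L2 L) (w : LineL2) {I : ℝ → ℂ} (hI : Integrable I) :
    Continuous (mildSolution g w I) :=
  (restrictL L).continuous.comp
    (continuous_translate (continuous_const.add (continuous_duhamel g hI)))

theorem integral_mildSolution_mul (g : L2 L) (w : LineL2) {I : ℝ → ℂ} (hI : Integrable I)
    {ζ : ℝ → ℂ} (hζ : MemLp ζ 2 (intervalMeasure L)) (t : ℝ) :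
    ∫ x in Ioo 0 L, mildSolution g w I t x * ζ x
      = (∫ x in Ioo 0 L, w (x + t) * ζ x)
        + ∫ s in (0 : ℝ)..t, I s * ∫ x in Ioo 0 L, zeroExt g (x + (t - s)) * ζ x := by
  rw [← integral_translate_duhamel g hI hζ, ← pairing_apply hζ, ← pairing_apply hζ,
    mildSolution, map_add, map_add, map_add, pairing_apply]
  congr 1
  apply integral_congr_ae
  filter_upwards [coeFn_restrictL_translate L t w] with x hx
  rw [hx]

/-! ### Integrals of translates against continuous functions -/

section TranslatePairing

variable {f : ℝ → ℂ} {k : ℝ × ℝ → ℂ}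

theorem stronglyMeasurable_integral_translate (L : ℝ) (hf : StronglyMeasurable f)
    (hk : Continuous k) :
    StronglyMeasurable fun p : ℝ × ℝ => ∫ x in Ioo 0 L, f (x + (p.1 - p.2)) * k (p.1, x) := by
  have h1 : Measurable fun q : (ℝ × ℝ) × ℝ => q.2 + (q.1.1 - q.1.2) := by fun_prop
  have h2 : Continuous fun q : (ℝ × ℝ) × ℝ => k (q.1.1, q.2) := by fun_prop
  exact ((hf.comp_measurable h1).mul h2.stronglyMeasurable).integral_prod_right

/-- The `L¹` norm of a translate does not depend on the shift, so the bound is uniform in `s`; it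
supplies the integrability needed for Fubini and for splitting integrals. -/
theorem exists_norm_integral_translate_le (L τ : ℝ) (hf : Integrable f) (hk : Continuous k) :
    ∃ C : ℝ, ∀ t ∈ Icc 0 τ, ∀ s, ‖∫ x in Ioo 0 L, f (x + (t - s)) * k (t, x)‖ ≤ C := by
  obtain ⟨C, hC⟩ := (isCompact_Icc (a := (0 : ℝ)) (b := τ)).prod
    (isCompact_Icc (a := (0 : ℝ)) (b := L)) |>.exists_bound_of_continuousOn hk.continuousOn
  refine ⟨(∫ x, ‖f x‖) * max C 0, fun t ht s => ?_⟩
  refine (norm_integral_le_integral_norm _).trans ?_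
  have hi : Integrable fun x => ‖f (x + (t - s))‖ * max C 0 :=
    (hf.comp_add_right (t - s)).norm.mul_const _
  calc ∫ x in Ioo 0 L, ‖f (x + (t - s)) * k (t, x)‖
      ≤ ∫ x in Ioo 0 L, ‖f (x + (t - s))‖ * max C 0 := by
        refine integral_mono_of_nonneg (Filter.Eventually.of_forall fun _ => norm_nonneg _)
          hi.restrict ?_
        filter_upwards [ae_restrict_mem measurableSet_Ioo] with x hx
        rw [norm_mul]
        exact mul_le_mul_of_nonneg_left
          (le_max_of_le_left (hC (t, x) ⟨ht, Ioo_subset_Icc_self hx⟩)) (norm_nonneg _)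
    _ ≤ ∫ x, ‖f (x + (t - s))‖ * max C 0 :=
        setIntegral_le_integral hi (Filter.Eventually.of_forall fun _ => by positivity)
    _ = (∫ x, ‖f x‖) * max C 0 := by
        rw [integral_mul_const, integral_add_right_eq_self (fun x => ‖f x‖)]

end TranslatePairing

/-! ### Mild solutions are weak solutions -/

/-- The nonlocal part of the adjoint symbol does not depend on `x`, so its pairing with `v` factors
through the mean of `v`. -/
theorem setIntegral_conj_symbol_sub {G : Kernel2 L} {g : L2 L}
    (hG : ∀ᵐ p ∂(squareMeasure L), G p = g p.1) {φ : ℝ × ℝ → ℂ} (hφ : ContDiff ℝ 1 φ)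
    (v : L2 L) (t : ℝ) :
    ∫ x in Ioo 0 L, v x * conj (-deriv (fun s => φ (s, x)) t + deriv (fun y => φ (t, y)) x
        - ∫ y in Ioo 0 L, conj (G (y, x)) * φ (t, y))
      = (∫ x in Ioo 0 L, v x * transportSymbol φ t x)
        - (∫ x in Ioo 0 L, v x) * ∫ y in Ioo 0 L, g y * conj (φ (t, y)) := by
  have hq : Continuous (transportSymbol φ t) :=
    (continuous_transportSymbol hφ).comp (continuous_const.prodMk continuous_id)
  rw [← integral_mul_const, ← integral_sub (integrable_mul_continuous v.integrable hq)
    (v.integrable.mul_const _)]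
  apply integral_congr_ae
  filter_upwards [kernel_ae_left hG] with x hx
  have : conj (∫ y in Ioo 0 L, conj (G (y, x)) * φ (t, y))
      = ∫ y in Ioo 0 L, g y * conj (φ (t, y)) := by
    rw [← integral_conj]
    apply integral_congr_ae
    filter_upwards [hx] with y hy
    rw [hy, map_mul, Complex.conj_conj]
  rw [map_sub, this, transportSymbol]; ring

/-- Exchange the integrals over `0 < s < t < τ`: for fixed `s` the profile `g` is launched at time
`s` and freely transported, so `integral_transport_from` applies. -/
theorem integral_duhamel_transport (hL : 0 < L) (g : L2 L) {I : ℝ → ℂ} (hI : Integrable I)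
    {τ : ℝ} {φ : ℝ × ℝ → ℂ} (hφ : ContDiff ℝ 1 φ)
    (hφ0 : ∀ t ∈ Icc 0 τ, φ (t, 0) = 0) :
    IntegrableOn (fun t => ∫ s in (0 : ℝ)..t,
        I s * ∫ x in Ioo 0 L, zeroExt g (x + (t - s)) * transportSymbol φ t x) (Ioo 0 τ) ∧
    ∫ t in Ioo 0 τ, (∫ s in (0 : ℝ)..t,
        I s * ∫ x in Ioo 0 L, zeroExt g (x + (t - s)) * transportSymbol φ t x)
      = ∫ s in Ioo 0 τ, I s * ((∫ x in Ioo 0 L, g x * conj (φ (s, x)))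
        - ∫ x in Ioo 0 L, zeroExt g (x + (τ - s)) * conj (φ (τ, x))) := by
  set Q : ℝ × ℝ → ℂ := fun p =>
    ∫ x in Ioo 0 L, zeroExt g (x + (p.1 - p.2)) * transportSymbol φ p.1 x with hQ
  have hQm : StronglyMeasurable Q := stronglyMeasurable_integral_translate L
    (stronglyMeasurable_zeroExt g) (continuous_transportSymbol hφ)
  obtain ⟨C, hC⟩ := exists_norm_integral_translate_le L τ (integrable_zeroExt g)
    (continuous_transportSymbol hφ)
  have hC0 : ∀ t ∈ Icc 0 τ, ∀ s, ‖Q (t, s)‖ ≤ C := hC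
  have hint : Integrable (fun p : ℝ × ℝ => I p.2 * {p : ℝ × ℝ | p.2 < p.1}.indicator Q p)
      ((intervalMeasure τ).prod (intervalMeasure τ)) := by
    refine (hI.restrict.comp_snd (intervalMeasure τ)).mul_bdd (c := C)
      (hQm.indicator (measurableSet_lt measurable_snd measurable_fst)).aestronglyMeasurable ?_
    have : ∀ᵐ p ∂(intervalMeasure τ).prod (intervalMeasure τ), p.1 ∈ Ioo 0 τ :=
      Measure.quasiMeasurePreserving_fst.ae (ae_restrict_mem measurableSet_Ioo)
    filter_upwards [this] with p hp
    exact (norm_indicator_le_norm_self _ _).trans (hC0 p.1 (Ioo_subset_Icc_self hp) p.2)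
  have hswap := integral_integral_swap (μ := intervalMeasure τ) (ν := intervalMeasure τ)
    (f := fun t s => I s * {p : ℝ × ℝ | p.2 < p.1}.indicator Q (t, s)) hint
  have e1 : ∀ t ∈ Ioo 0 τ, (∫ s in (0 : ℝ)..t, I s * Q (t, s))
      = ∫ s in Ioo 0 τ, I s * {p : ℝ × ℝ | p.2 < p.1}.indicator Q (t, s) := by
    intro t ht
    rw [intervalIntegral.integral_of_le ht.1.le, integral_Ioc_eq_integral_Ioo]
    have : ∀ s, I s * {p : ℝ × ℝ | p.2 < p.1}.indicator Q (t, s)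
        = (Iio t).indicator (fun s => I s * Q (t, s)) s := by
      intro s
      by_cases hs : s < t <;> simp [indicator, hs]
    simp only [this]
    rw [setIntegral_indicator measurableSet_Iio]
    congr 2
    ext y; simp only [mem_Ioo, mem_inter_iff, mem_Iio]
    constructor
    · rintro ⟨a, b⟩; exact ⟨⟨a, b.trans ht.2⟩, b⟩
    · rintro ⟨a, b⟩; exact ⟨a.1, b⟩
  refine ⟨?_, ?_⟩
  · exact IntegrableOn.congr_fun (f := fun t => ∫ s in Ioo 0 τ,
      I s * {p : ℝ × ℝ | p.2 < p.1}.indicator Q (t, s)) hint.integral_prod_left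
      (fun t ht => (e1 t ht).symm) measurableSet_Ioo
  refine (setIntegral_congr_fun measurableSet_Ioo e1).trans (hswap.trans ?_)
  refine setIntegral_congr_fun measurableSet_Ioo fun s hs => ?_
  rw [integral_const_mul]
  congr 1
  have e2 : ∫ t in Ioo 0 τ, {p : ℝ × ℝ | p.2 < p.1}.indicator Q (t, s)
      = ∫ t in Ioo s τ, Q (t, s) := by
    have : ∀ t, {p : ℝ × ℝ | p.2 < p.1}.indicator Q (t, s)
        = (Ioi s).indicator (fun t => Q (t, s)) t := by
      intro t
      by_cases hst : s < t <;> simp [indicator, hst]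
    simp only [this]
    rw [setIntegral_indicator measurableSet_Ioi]
    congr 2
    ext y; simp only [mem_Ioo, mem_inter_iff, mem_Ioi]
    constructor
    · rintro ⟨a, b⟩; exact ⟨b, a.2⟩
    · rintro ⟨a, b⟩; exact ⟨⟨hs.1.trans a, b⟩, a⟩
  rw [e2]
  refine (integral_transport_from hL hs.1.le hs.2.le (integrable_zeroExt g) hφ hφ0
    fun x hx => zeroExt_of_notMem g fun h => lt_asymm hx h.2).trans ?_
  congr 1
  exact setIntegral_congr_fun measurableSet_Ioo fun x hx => by
    simp only [zeroExt_of_mem g hx]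

/-- By `hmean` the nonlocal term is paired with `I` itself. The transport identity for `w` yields
the initial and control terms; in the Duhamel part the contribution at the launching time `s`
cancels the source term, and the contribution at `τ` completes the final state. -/
theorem isWeakSolution_mildSolution {G : Kernel2 L} {g : L2 L} (hL : 0 < L)
    (hG : ∀ᵐ p ∂(squareMeasure L), G p = g p.1) {T : ℝ} {w : LineL2} (hw : Integrable w)
    {I : ℝ → ℂ} (hI : Integrable I)
    (hmean : ∀ᵐ t ∂(intervalMeasure T), ∫ x in Ioo 0 L, mildSolution g w I t x = I t)
    {u₀ : L2 L} (hu₀ : u₀ =ᵐ[intervalMeasure L] w) {U : L2 T}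
    (hU : U =ᵐ[intervalMeasure T] fun t => w (t + L)) :
    IsWeakSolution L G T u₀ U (mildSolution g w I) := by
  refine ⟨(continuous_mildSolution g w hI).continuousOn, fun τ hτ φ hφ hφ0 => ?_⟩
  have hsub : Ioo 0 τ ⊆ Ioo 0 T := Ioo_subset_Ioo_right hτ.2
  have hφc : Continuous fun p => conj (φ p) := Complex.continuous_conj.comp hφ.continuous
  have hφx : ∀ t, Continuous fun x => conj (φ (t, x)) := fun t =>
    hφc.comp (continuous_const.prodMk continuous_id)
  have hq : ∀ t, Continuous (transportSymbol φ t) := fun t =>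
    (continuous_transportSymbol hφ).comp (continuous_const.prodMk continuous_id)
  set γ : ℝ → ℂ := fun t => ∫ y in Ioo 0 L, g y * conj (φ (t, y)) with hγ
  have hγ' : ∀ t, γ t = ∫ y in Ioo 0 L, zeroExt g (y + (t - t)) * conj (φ (t, y)) := fun t =>
    setIntegral_congr_fun measurableSet_Ioo fun x hx => by
      simp only [sub_self, add_zero, zeroExt_of_mem g hx]
  have hIγ : IntegrableOn (fun t => I t * γ t) (Ioo 0 τ) := by
    obtain ⟨C, hC⟩ := exists_norm_integral_translate_le L τ (integrable_zeroExt g) hφc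
    have hm : StronglyMeasurable γ := by
      rw [funext hγ']
      exact (stronglyMeasurable_integral_translate L (stronglyMeasurable_zeroExt g)
        hφc).comp_measurable (measurable_id.prodMk measurable_id)
    refine hI.restrict.mul_bdd (c := C) hm.aestronglyMeasurable ?_
    filter_upwards [ae_restrict_mem measurableSet_Ioo] with t ht
    rw [hγ']
    exact hC t (Ioo_subset_Icc_self ht) t
  set R : ℝ → ℂ := fun s => ∫ x in Ioo 0 L, zeroExt g (x + (τ - s)) * conj (φ (τ, x)) with hR
  have hIR : IntegrableOn (fun t => I t * R t) (Ioo 0 τ) := by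
    obtain ⟨C, hC⟩ := exists_norm_integral_translate_le L τ (integrable_zeroExt g) hφc
    have hm : StronglyMeasurable R := (stronglyMeasurable_integral_translate L
      (stronglyMeasurable_zeroExt g) hφc).comp_measurable (measurable_const.prodMk measurable_id)
    exact hI.restrict.mul_bdd (c := C) hm.aestronglyMeasurable
      (Filter.Eventually.of_forall fun s => hC τ (right_mem_Icc.2 hτ.1) s)
  set A : ℝ → ℂ := fun t => ∫ x in Ioo 0 L, w (x + t) * transportSymbol φ t x with hA
  have hAi : IntegrableOn A (Ioo 0 τ) := by
    obtain ⟨C, hC⟩ := exists_norm_integral_translate_le L τ hw (continuous_transportSymbol hφ)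
    have hA' : A = fun t => ∫ x in Ioo 0 L, w (x + (t - 0)) * transportSymbol φ t x := by
      simp only [sub_zero, hA]
    have hm : StronglyMeasurable A := by
      rw [hA']
      exact (stronglyMeasurable_integral_translate L (Lp.stronglyMeasurable w)
        (continuous_transportSymbol hφ)).comp_measurable (measurable_id.prodMk measurable_const)
    refine Integrable.of_bound hm.aestronglyMeasurable C ?_
    filter_upwards [ae_restrict_mem measurableSet_Ioo] with t ht
    rw [hA']
    exact hC t (Ioo_subset_Icc_self ht) 0
  obtain ⟨hDi, hD⟩ := integral_duhamel_transport hL g hI hφ hφ0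
  have t1 : ∫ t in Ioo 0 τ, ∫ x in Ioo 0 L, mildSolution g w I t x *
        conj (-deriv (fun s => φ (s, x)) t + deriv (fun y => φ (t, y)) x
          - ∫ y in Ioo 0 L, conj (G (y, x)) * φ (t, y))
      = (∫ t in Ioo 0 τ, A t) + (∫ s in Ioo 0 τ, I s * (γ s - R s))
        - ∫ t in Ioo 0 τ, I t * γ t := by
    rw [← hD, ← integral_add hAi hDi, ← integral_sub (Integrable.fun_add hAi hDi) hIγ]
    apply integral_congr_ae
    filter_upwards [ae_restrict_of_ae_restrict_of_subset hsub hmean] with t ht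
    rw [setIntegral_conj_symbol_sub hG hφ, ht,
      integral_mildSolution_mul g w hI (memLp_of_continuous L (hq t))]
  have t2 : ∫ x in Ioo 0 L, mildSolution g w I τ x * conj (φ (τ, x))
      = (∫ x in Ioo 0 L, w (x + τ) * conj (φ (τ, x))) + ∫ s in Ioo 0 τ, I s * R s := by
    rw [integral_mildSolution_mul g w hI (memLp_of_continuous L (hφx τ)),
      intervalIntegral.integral_of_le hτ.1, integral_Ioc_eq_integral_Ioo]
  have t3 : ∫ x in Ioo 0 L, u₀ x * conj (φ (0, x)) = ∫ x in Ioo 0 L, w x * conj (φ (0, x)) := by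
    apply integral_congr_ae
    filter_upwards [hu₀] with x hx
    rw [hx]
  have t4 : ∫ t in Ioo 0 τ, U t * conj (φ (t, L))
      = ∫ t in Ioo 0 τ, w (t + L) * conj (φ (t, L)) := by
    apply integral_congr_ae
    filter_upwards [ae_restrict_of_ae_restrict_of_subset hsub hU] with x hx
    rw [hx]
  have t5 : ∫ s in Ioo 0 τ, I s * (γ s - R s)
      = (∫ s in Ioo 0 τ, I s * γ s) - ∫ s in Ioo 0 τ, I s * R s := by
    rw [← integral_sub hIγ hIR]
    simp only [mul_sub]
  have t6 := integral_transport hL hτ.1 hw hφ hφ0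
  rw [t1, t2, t3, t4, t5]
  linear_combination t6

/-! ### Steering to a target -/

section Steering

variable {L : ℝ}

/-- The data transported along characteristics: the initial state on `(0, L)`, the control on
`(L, 2 L)`. -/
def transportedData (u₀ U : L2 L) : LineL2 := zeroExtLp u₀ + translate (-L) (zeroExtLp U)

theorem coeFn_transportedData (u₀ U : L2 L) :
    transportedData u₀ U =ᵐ[volume] fun x => zeroExt u₀ x + zeroExt U (x - L) := by
  have h := (measurePreserving_add_right volume (-L)).quasiMeasurePreserving.ae
    (coeFn_zeroExtLp U)
  filter_upwards [Lp.coeFn_add (zeroExtLp u₀) (translate (-L) (zeroExtLp U)),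
    coeFn_zeroExtLp u₀, coeFn_translate (-L) (zeroExtLp U), h] with x h1 h2 h3 h4
  rw [transportedData, h1, Pi.add_apply, h2, h3, h4, sub_eq_add_neg]

theorem integrable_transportedData (u₀ U : L2 L) : Integrable (transportedData u₀ U) :=
  ((integrable_zeroExt u₀).add ((integrable_zeroExt U).comp_sub_right L)).congr
    (coeFn_transportedData u₀ U).symm

theorem transportedData_initial (u₀ U : L2 L) :
    u₀ =ᵐ[intervalMeasure L] transportedData u₀ U := by
  filter_upwards [ae_restrict_of_ae (coeFn_transportedData u₀ U),
    ae_restrict_mem measurableSet_Ioo] with x h1 hx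
  rw [h1, zeroExt_of_mem u₀ hx,
    zeroExt_of_notMem U (x := x - L) (by rintro ⟨h, -⟩; linarith [hx.2]), add_zero]

theorem transportedData_control (u₀ U : L2 L) :
    U =ᵐ[intervalMeasure L] fun t => transportedData u₀ U (t + L) := by
  have h := (measurePreserving_add_right volume L).quasiMeasurePreserving.ae
    (coeFn_transportedData u₀ U)
  filter_upwards [ae_restrict_of_ae h, ae_restrict_mem measurableSet_Ioo] with x h1 hx
  rw [h1, add_sub_cancel_right, zeroExt_of_mem U hx,
    zeroExt_of_notMem u₀ (x := x + L) (by rintro ⟨-, h⟩; linarith [hx.1]), zero_add]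

/-- The window `(t, t + L)` sees `u₀` on `(t, L)` and `U` on `(0, t)`. -/
theorem setIntegral_transportedData (u₀ U : L2 L) {t : ℝ} (ht : t ∈ Ioo 0 L) :
    ∫ x in Ioo 0 L, transportedData u₀ U (x + t)
      = (∫ x in Ioo 0 L, u₀ x) - (∫ x in Ioo 0 t, u₀ x) + ∫ x in Ioo 0 t, U x := by
  have h0 : ∀ (v : L2 L) (a : ℝ), a ≤ L → ∫ x in Ioo 0 a, v x = ∫ x in Ioo 0 a, zeroExt v x :=
    fun v a ha => setIntegral_congr_fun measurableSet_Ioo fun x hx =>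
      (zeroExt_of_mem v ⟨hx.1, hx.2.trans_le ha⟩).symm
  have hneg : tailIntegral U (t - L) = tailIntegral U 0 := by
    have := setIntegral_Ioo_zeroExt U (a := t - L) (b := 0) (by linarith [ht.2])
    rw [setIntegral_congr_fun (g := fun _ => 0) measurableSet_Ioo fun x hx =>
      zeroExt_of_notMem U fun h => lt_asymm hx.2 h.1, integral_zero] at this
    exact (sub_eq_zero.1 this.symm)
  rw [setIntegral_Ioo_comp_add (F := transportedData u₀ U),
    integral_congr_ae (ae_restrict_of_ae (coeFn_transportedData u₀ U)),
    integral_add (integrable_zeroExt u₀).integrableOn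
      ((integrable_zeroExt U).comp_sub_right L).integrableOn]
  have e := setIntegral_Ioo_comp_add (F := fun x => zeroExt U (x - L)) (t - L) t L
  simp only [add_sub_cancel_right, sub_add_cancel] at e
  rw [zero_add, add_comm L t, ← e, h0 u₀ L le_rfl, h0 u₀ t ht.2.le, h0 U t ht.2.le,
    setIntegral_Ioo_zeroExt _ (by linarith [ht.1, ht.2]),
    setIntegral_Ioo_zeroExt _ (by linarith [ht.1, ht.2]),
    setIntegral_Ioo_zeroExt _ (by linarith [ht.1, ht.2]),
    setIntegral_Ioo_zeroExt _ ht.1.le, setIntegral_Ioo_zeroExt _ ht.1.le, hneg,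
    tailIntegral_of_le u₀ (r := t + L) (by linarith [ht.1]), tailIntegral_of_le u₀ le_rfl]
  ring

theorem mildSolution_transportedData_self (g u₀ U : L2 L) (I : ℝ → ℂ) :
    mildSolution g (transportedData u₀ U) I L
      = U + restrictL L (translate L (duhamel g I L)) := by
  rw [mildSolution, map_add, map_add]
  congr 1
  apply Lp.ext
  exact (coeFn_restrictL_translate L L _).trans (transportedData_control u₀ U).symm

theorem setIntegral_mildSolution (g : L2 L) (w : LineL2) {I : ℝ → ℂ} (hI : Integrable I) {t : ℝ}
    (ht : 0 ≤ t) :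
    ∫ x in Ioo 0 L, mildSolution g w I t x
      = (∫ x in Ioo 0 L, w (x + t)) + ∫ s in Ioo 0 t, I s * tailIntegral g (t - s) := by
  rcases le_or_gt L 0 with hL | hL
  · have h0 : ∀ s ∈ Ioo 0 t, I s * tailIntegral g (t - s) = 0 := fun s hs => by
      rw [tailIntegral_of_le g (by linarith [hs.2]), mul_zero]
    rw [Ioo_eq_empty (not_lt.2 hL), setIntegral_congr_fun measurableSet_Ioo h0]
    simp
  have h := integral_mildSolution_mul g w hI (memLp_of_continuous L (continuous_const (y := 1))) t
  simp only [mul_one] at h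
  rw [h, intervalIntegral.integral_of_le ht, integral_Ioc_eq_integral_Ioo]
  congr 1
  refine setIntegral_congr_fun measurableSet_Ioo fun s hs => ?_
  -- The shifted window ends beyond `L`, so only its left end contributes.
  rw [setIntegral_Ioo_comp_add (F := zeroExt g), setIntegral_Ioo_zeroExt _ (by linarith),
    tailIntegral_of_le g (r := L + (t - s)) (by linarith [hs.2]), sub_zero, zero_add]

/-- Needed because the control contains the Duhamel term at time `L`, and the mean at time `t`
involves the control integrated over `(0, t)`. The proof pairs with the indicator of `x < t`. -/
theorem setIntegral_restrictL_duhamel (g : L2 L) {I : ℝ → ℂ} (hI : Integrable I) (hL : 0 < L)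
    {t : ℝ} (ht : t ∈ Ioo 0 L) :
    ∫ x in Ioo 0 t, restrictL L (translate L (duhamel g I L)) x
      = (∫ s in Ioo 0 L, I s * tailIntegral g (L - s))
        - ∫ s in Ioo 0 L, I s * tailIntegral g (L + t - s) := by
  have hζ : MemLp ((Iio t).indicator fun _ => (1 : ℂ)) 2 (intervalMeasure L) :=
    (memLp_const 1).indicator measurableSet_Iio
  have h := integral_translate_duhamel g hI hζ L L
  have hcut : ∀ F : ℝ → ℂ, ∫ x in Ioo 0 L, F x * (Iio t).indicator (fun _ => (1 : ℂ)) x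
      = ∫ x in Ioo 0 t, F x := by
    intro F
    have : ∀ x, F x * (Iio t).indicator (fun _ => (1 : ℂ)) x = (Iio t).indicator F x := by
      intro x
      by_cases hx : x < t <;> simp [indicator, hx]
    simp only [this]
    rw [setIntegral_indicator measurableSet_Iio]
    congr 2
    ext y; simp only [mem_Ioo, mem_inter_iff, mem_Iio]
    constructor
    · rintro ⟨a, b⟩; exact ⟨a.1, b⟩
    · rintro ⟨a, b⟩; exact ⟨⟨a, b.trans ht.2⟩, b⟩
  have hc : ∀ a : ℝ, Continuous fun s => tailIntegral g (a - s) := fun a =>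
    (continuous_tailIntegral g).comp (continuous_const.sub continuous_id)
  simp only [hcut] at h
  rw [h, intervalIntegral.integral_of_le hL.le, integral_Ioc_eq_integral_Ioo,
    ← integral_sub (integrable_mul_continuous hI.restrict (hc _))
      (integrable_mul_continuous hI.restrict (hc _))]
  refine setIntegral_congr_fun measurableSet_Ioo fun s _ => ?_
  rw [setIntegral_Ioo_comp_add (F := zeroExt g), setIntegral_Ioo_zeroExt _ (by linarith [ht.1]),
    zero_add, show t + (L - s) = L + t - s by ring, mul_sub]

theorem exactlyControllable_of_nonresonant {G : Kernel2 L} {g : L2 L} (hL : 0 < L)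
    (hG : ∀ᵐ p ∂(squareMeasure L), G p = g p.1) (hg : Nonresonant L g) :
    ExactlyControllable L G L := by
  intro u₀ u₁
  have : Fact (0 < L) := ⟨hL⟩
  -- This datum is the mean that pure transport would produce with control `u₁`.
  have hh : MemLp (fun t => (∫ x in Ioo 0 L, u₀ x) - (∫ x in Ioo 0 t, u₀ x)
      + ∫ x in Ioo 0 t, u₁ x) 2 (intervalMeasure L) :=
    ((memLp_const _).sub (memLp_primitive u₀.integrable)).add (memLp_primitive u₁.integrable)
  obtain ⟨I', hI', hIeq⟩ := exists_integral_equation_solution hg hh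
  set I : ℝ → ℂ := (Ioo 0 L).indicator I' with hIdef
  have hI : Integrable I := (integrable_indicator_iff measurableSet_Ioo).2 hI'
  have hII' : ∀ s ∈ Ioo 0 L, I s = I' s := fun s hs => indicator_of_mem hs _
  set D : L2 L := restrictL L (translate L (duhamel g I L)) with hD
  -- At time `L` the free part equals the control, so subtracting `D` meets the target for every
  -- `I`; the integral equation is used only to make `I` the mean of the solution.
  refine ⟨u₁ - D, mildSolution g (transportedData u₀ (u₁ - D)) I,
    isWeakSolution_mildSolution hL hG (integrable_transportedData _ _) hI ?_
      (transportedData_initial _ _) (transportedData_control _ _), ?_⟩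
  · filter_upwards [hIeq, ae_restrict_mem measurableSet_Ioo] with t h1 ht
    have e1 : ∫ x in Ioo 0 t, (u₁ - D) x = (∫ x in Ioo 0 t, u₁ x) - ∫ x in Ioo 0 t, D x := by
      have hsub : Ioo 0 t ⊆ Ioo 0 L := Ioo_subset_Ioo_right ht.2.le
      have i1 : IntegrableOn u₁ (Ioo 0 t) := IntegrableOn.mono_set u₁.integrable hsub
      have i2 : IntegrableOn D (Ioo 0 t) := IntegrableOn.mono_set D.integrable hsub
      rw [← integral_sub i1 i2]
      apply integral_congr_ae
      exact ae_restrict_of_ae_restrict_of_subset hsub (Lp.coeFn_sub u₁ D)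
    have cg : ∀ (F : ℝ → ℂ) (a : ℝ), a ≤ L →
        ∫ s in Ioo 0 a, I s * F s = ∫ s in Ioo 0 a, I' s * F s := fun F a ha =>
      setIntegral_congr_fun measurableSet_Ioo fun s hs => by
        simp only [hII' s ⟨hs.1, hs.2.trans_le ha⟩]
    rw [setIntegral_mildSolution g _ hI ht.1.le, setIntegral_transportedData u₀ _ ht, e1, hD,
      setIntegral_restrictL_duhamel g hI hL ht, hII' t ht, h1, cg _ t ht.2.le, cg _ L le_rfl,
      cg _ L le_rfl]
    ring
  · rw [mildSolution_transportedData_self, sub_add_cancel]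

end Steering

end TransportControl

end

theorem theorem2 (L : ℝ) (hL : 0 < L) (G : TransportControl.Kernel2 L)
    (g : TransportControl.L2 L)
    (hG : ∀ᵐ p ∂(TransportControl.squareMeasure L), G p = g p.1) :
    TransportControl.ExactlyControllable L G L ↔ TransportControl.FattoriniCriterion G :=
  ⟨fun h => TransportControl.fattorini_of_nonresonant hL hG
      (TransportControl.nonresonant_of_exactlyControllable hL.le hG h),
    fun h => TransportControl.exactlyControllable_of_nonresonant hL hG
      (TransportControl.nonresonant_of_fattorini hL hG h)⟩
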